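/- Let $G$ be a compact Lie group with Lie algebra $\mathfrak g$. All $G$-modules are finite-dimensional and smooth; $\mathrm{Irr}(G,\mathbb C)$ denotes the irreducible complex $G$-modules up to isomorphism, and $\rho_V$ is the action on $V$. A module $V\in\mathrm{Irr}(G,\mathbb C)$ is of real (resp. quaternionic) type if there is a conjugate linear $G$-map $J:V\to V$ with $J^2=\mathrm{Id}$ (resp. $J^2=-\mathrm{Id}$), and of complex type if it is of neither real nor quaternionic type. Let $\mathrm{Sym}^2(\mathfrak g)$ be the real span of the elements $Y\cdot Z:=\tfrac12(Y\otimes Z+Z\otimes Y)$, $Y,Z\in\mathfrak g$, and let $D_V:\mathrm{Sym}^2(\mathfrak g)\to\mathrm{End}(V)$ be the linear map with $D_V(Y\cdot Z)=-\tfrac12\bigl((\rho_V)_*(Y)(\rho_V)_*(Z)+(\rho_V)_*(Z)(\rho_V)_*(Y)\bigr)$. For $s\in\mathrm{Sym}^2(\mathfrak g)$ let $p_V(s)=\det(D_V(s)-X\cdot\mathrm{Id})\in\mathbb C[X]$, and let $p_V'(s),p_V''(s)$ be its formal derivatives in $X$. With $\mathrm{Res}$ the resultant, define polynomial functions on $\mathrm{Sym}^2(\mathfrak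 g)$ by $$a_{V,W}=\mathrm{Res}(p_V,p_W),\qquad b_V=\mathrm{Res}(p_V,p_V'),\qquad c_V=\mathrm{Res}(p_V,p_V'').$$ Consider the following conditions on $G$: (a) $a_{V,W}\not\equiv 0$ for all $V,W\in\mathrm{Irr}(G,\mathbb C)$ with $V\not\cong W$ and $V^*\not\cong W$; (b) $b_V\not\equiv 0$ for all $V\in\mathrm{Irr}(G,\mathbb C)$ of real or complex type; (c) $c_V\not\equiv 0$ for all $V\in\mathrm{Irr}(G,\mathbb C)$ of quaternionic type. **Proposition.** Let $G$ and $G'$ be compact Lie groups that both satisfy (a), (b) and (c). For $V\in\mathrm{Irr}(G,\mathbb C)$ and $V'\in\mathrm{Irr}(G',\mathbb C)$ let $G\times G'$ act on $V\otimes V'$ by $\rho_{V\otimes V'}(x,x')=\rho_V(x)\otimes\rho_{V'}(x')$. Then $G\times G'$ satisfies (c). Moreover: (i) $G\times G'$ satisfies (a) if and only if $a_{V\otimes V',\,V^*\otimes V'}\not\equiv 0$ and $a_{V\otimes V',\,V\otimes V'^*}\not\equiv 0$ whenever $V\in\mathrm{Irr}(G,\mathbb C)$ and $V'\in\mathrm{Irr}(G',\mathbb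 C)$ are both of complex type. (ii) $G\times G'$ satisfies (b) if and only if $b_{V\otimes V'}\not\equiv 0$ whenever $V\in\mathrm{Irr}(G,\mathbb C)$ and $V'\in\mathrm{Irr}(G',\mathbb C)$ are both of quaternionic type, or one of them is of quaternionic type and the other of complex type. -/

import Mathlib

open scoped Manifold ContDiff TensorProduct

universe w

noncomputable section

namespace LieRep

section Reps

variable {E : Type*} [NormedAddCommGroup E] [NormedSpace ℝ E]
  {H : Type*} [TopologicalSpace H] (I : ModelWithCorners ℝ E H)
  {G : Type*} [TopologicalSpace G] [ChartedSpace H G] [Group G]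
  {V : Type*} [AddCommGroup V] [Module ℂ V]
  {W : Type*} [AddCommGroup W] [Module ℂ W]

/-- A complex representation of a Lie group is smooth if all its matrix coefficients
`x ↦ φ (ρ x v)` are smooth functions on the group. For finite dimensional `V` this says that
`ρ : G → GL(V)` is a homomorphism of Lie groups. -/
def IsSmooth (ρ : Representation ℂ G V) : Prop :=
  ∀ (v : V) (φ : Module.Dual ℂ V), ContMDiff I 𝓘(ℝ, ℂ) ∞ (fun x : G => φ (ρ x v))

/-- The irreducible complex `G`-modules: smooth irreducible representations (the zero space is
not irreducible). Finite dimensionality is kept as a separate instance argument. -/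
structure IsIrr (ρ : Representation ℂ G V) : Prop where
  smooth : IsSmooth I ρ
  irreducible : ρ.IsIrreducible

/-- Isomorphism of `G`-modules. -/
def Iso (ρ : Representation ℂ G V) (σ : Representation ℂ G W) : Prop :=
  Nonempty (ρ.Equiv σ)

/-- There is a conjugate linear `G`-map `J : V → V` with `J² = Id`. -/
def IsRealType (ρ : Representation ℂ G V) : Prop :=
  ∃ J : V →ₛₗ[starRingEnd ℂ] V, (∀ x v, J (ρ x v) = ρ x (J v)) ∧ ∀ v, J (J v) = v

/-- There is a conjugate linear `G`-map `J : V → V` with `J² = -Id`. -/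
def IsQuaternionicType (ρ : Representation ℂ G V) : Prop :=
  ∃ J : V →ₛₗ[starRingEnd ℂ] V, (∀ x v, J (ρ x v) = ρ x (J v)) ∧ ∀ v, J (J v) = -v

/-- Neither of real nor of quaternionic type. -/
def IsComplexType (ρ : Representation ℂ G V) : Prop :=
  ¬ IsRealType ρ ∧ ¬ IsQuaternionicType ρ

variable [FiniteDimensional ℂ V] [FiniteDimensional ℂ W]

/-- The `(i, j)` matrix entry of a representation, as a function on the group. -/
def entry (ρ : Representation ℂ G V) (i j : Fin (Module.finrank ℂ V)) (x : G) : ℂ :=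
  (Module.finBasis ℂ V).repr (ρ x (Module.finBasis ℂ V j)) i

/-- The differential at the identity of a matrix entry, as a linear form on the Lie algebra. -/
def dEntry (ρ : Representation ℂ G V) (i j : Fin (Module.finrank ℂ V)) :
    GroupLieAlgebra I G →ₗ[ℝ] ℂ :=
  (mfderiv I 𝓘(ℝ, ℂ) (entry ρ i j) (1 : G)).toLinearMap

/-- The differential `ρ_* : 𝔤 → End(V)` at the identity, computed entrywise in a basis of `V`.
See `apply_differential` for the basis-free description. -/
def differential (ρ : Representation ℂ G V) :
    GroupLieAlgebra I G →ₗ[ℝ] Module.End ℂ V :=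
  ((Matrix.toLin (Module.finBasis ℂ V) (Module.finBasis ℂ V)).toLinearMap.restrictScalars ℝ) ∘ₗ
    LinearMap.pi (fun i => LinearMap.pi (fun j => dEntry I ρ i j))

theorem apply_differential {ρ : Representation ℂ G V} (hρ : IsSmooth I ρ)
    (Y : GroupLieAlgebra I G) (v : V) (φ : Module.Dual ℂ V) :
    φ (differential I ρ Y v) = mfderiv I 𝓘(ℝ, ℂ) (fun x : G => φ (ρ x v)) (1 : G) Y := by
  set b := Module.finBasis ℂ V with hb
  let c : Fin (Module.finrank ℂ V) × Fin (Module.finrank ℂ V) → ℂ :=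
    fun p => b.repr v p.2 * φ (b p.1)
  let L : ℂ → ℂ →L[ℝ] ℂ := fun z => (ContinuousLinearMap.mul ℝ ℂ) z
  have hf : (fun x : G => φ (ρ x v)) =
      ∑ p : Fin (Module.finrank ℂ V) × Fin (Module.finrank ℂ V),
        (fun x => L (c p) (entry ρ p.1 p.2 x)) := by
    funext x
    rw [Finset.sum_apply, Fintype.sum_prod_type, Finset.sum_comm]
    conv_lhs => rw [← b.sum_repr v]
    simp only [map_sum, map_smul]
    refine Finset.sum_congr rfl fun j _ => ?_
    conv_lhs => rw [← b.sum_repr (ρ x (b j))]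
    simp only [map_sum, map_smul, smul_eq_mul, Finset.mul_sum]
    refine Finset.sum_congr rfl fun i _ => ?_
    simp only [L, c, entry, ContinuousLinearMap.mul_apply', ← hb]
    ring
  have hd : HasMFDerivAt I 𝓘(ℝ, ℂ) (fun x : G => φ (ρ x v)) (1 : G)
      (∑ p : Fin (Module.finrank ℂ V) × Fin (Module.finrank ℂ V),
        (L (c p)).comp (mfderiv I 𝓘(ℝ, ℂ) (entry ρ p.1 p.2) (1 : G))) := by
    rw [hf]
    refine HasMFDerivAt.sum fun p _ => ?_
    have he : HasMFDerivAt I 𝓘(ℝ, ℂ) (entry ρ p.1 p.2) (1 : G)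
        (mfderiv I 𝓘(ℝ, ℂ) (entry ρ p.1 p.2) (1 : G)) :=
      ((hρ (b p.2) (b.coord p.1)).mdifferentiable (by simp) 1).hasMFDerivAt
    exact (L (c p)).hasMFDerivAt.comp (1 : G) he
  rw [hd.mfderiv]
  have hl : differential I ρ Y v = ∑ i, (∑ j, dEntry I ρ i j Y * b.repr v j) • b i := by
    have h0 : differential I ρ Y = Matrix.toLin b b (Matrix.of fun i j => dEntry I ρ i j Y) :=
      rfl
    rw [h0, Matrix.toLin_apply]
    rfl
  have hr : (∑ p : Fin (Module.finrank ℂ V) × Fin (Module.finrank ℂ V),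
      (L (c p)).comp (mfderiv I 𝓘(ℝ, ℂ) (entry ρ p.1 p.2) (1 : G))) Y =
      ∑ p : Fin (Module.finrank ℂ V) × Fin (Module.finrank ℂ V), c p * dEntry I ρ p.1 p.2 Y :=
    sum_apply _ _ _
  refine Eq.trans ?_ hr.symm
  rw [hl, Fintype.sum_prod_type]
  simp only [map_sum, map_smul, smul_eq_mul, Finset.sum_mul, c]
  refine Finset.sum_congr rfl fun i _ => Finset.sum_congr rfl fun j _ => ?_
  ring

/-- The second symmetric tensor power `Sym²(𝔤)`, the real span of all
`Y·Z = ½ (Y ⊗ Z + Z ⊗ Y)`. -/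
def symSq (𝔤 : Type*) [AddCommGroup 𝔤] [Module ℝ 𝔤] : Submodule ℝ (𝔤 ⊗[ℝ] 𝔤) :=
  Submodule.span ℝ {t | ∃ Y Z : 𝔤, t = (1 / 2 : ℝ) • (Y ⊗ₜ[ℝ] Z + Z ⊗ₜ[ℝ] Y)}

/-- The linear map `D_V : Sym²(𝔤) → End(V)` given by
`Y·Z ↦ -½ (ρ_*(Y) ∘ ρ_*(Z) + ρ_*(Z) ∘ ρ_*(Y))`: it is the restriction to `Sym²(𝔤)` of the linear
map on `𝔤 ⊗ 𝔤` which sends `Y ⊗ Z` to the same expression. -/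
def symOp (ρ : Representation ℂ G V) :
    symSq (GroupLieAlgebra I G) →ₗ[ℝ] Module.End ℂ V :=
  (TensorProduct.lift (LinearMap.mk₂ ℝ
    (fun Y Z : GroupLieAlgebra I G => -((1 / 2 : ℝ) •
      (differential I ρ Y ∘ₗ differential I ρ Z + differential I ρ Z ∘ₗ differential I ρ Y)))
    (fun Y Y' Z => by
      simp only [map_add, LinearMap.add_comp, LinearMap.comp_add, smul_add]; abel)
    (fun c Y Z => by
      simp only [map_smul, LinearMap.smul_comp, LinearMap.comp_smul]; module)
    (fun Y Z Z' => by
      simp only [map_add, LinearMap.add_comp, LinearMap.comp_add, smul_add]; abel)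
    (fun c Y Z => by
      simp only [map_smul, LinearMap.smul_comp, LinearMap.comp_smul]; module))).domRestrict
      (symSq (GroupLieAlgebra I G))

theorem symOp_apply (ρ : Representation ℂ G V) (Y Z : GroupLieAlgebra I G)
    (h : (1 / 2 : ℝ) • (Y ⊗ₜ[ℝ] Z + Z ⊗ₜ[ℝ] Y) ∈ symSq (GroupLieAlgebra I G)) :
    symOp I ρ ⟨_, h⟩ = -((1 / 2 : ℝ) •
      (differential I ρ Y ∘ₗ differential I ρ Z + differential I ρ Z ∘ₗ differential I ρ Y)) := by
  simp only [symOp, LinearMap.domRestrict_apply, map_smul, map_add, TensorProduct.lift.tmul,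
    LinearMap.mk₂_apply]
  module

/-- `p_V(s) = det (D_V(s) - X · Id)`, which is `(-1)^{dim V}` times the monic characteristic
polynomial `det (X · Id - D_V(s))`. -/
def charP (ρ : Representation ℂ G V) (s : symSq (GroupLieAlgebra I G)) : Polynomial ℂ :=
  (-1) ^ Module.finrank ℂ V * (symOp I ρ s).charpoly

theorem eval_charP (ρ : Representation ℂ G V) (s : symSq (GroupLieAlgebra I G)) (z : ℂ) :
    (charP I ρ s).eval z = LinearMap.det (symOp I ρ s - z • LinearMap.id) := by
  have h : symOp I ρ s - z • LinearMap.id = (-1 : ℂ) • (algebraMap ℂ (Module.End ℂ V) z -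
      symOp I ρ s) := by
    ext v
    simp [Algebra.algebraMap_eq_smul_one]
  rw [h, LinearMap.det_smul, charP, Polynomial.eval_mul, LinearMap.eval_charpoly]
  simp

/-- `a_{V,W} = Res(p_V, p_W)`, a polynomial function on `Sym²(𝔤)`. -/
def aPoly (ρ : Representation ℂ G V) (σ : Representation ℂ G W)
    (s : symSq (GroupLieAlgebra I G)) : ℂ :=
  (charP I ρ s).resultant (charP I σ s)

/-- `b_V = Res(p_V, p_V')`. -/
def bPoly (ρ : Representation ℂ G V) (s : symSq (GroupLieAlgebra I G)) : ℂ :=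
  (charP I ρ s).resultant (charP I ρ s).derivative

/-- `c_V = Res(p_V, p_V'')`. -/
def cPoly (ρ : Representation ℂ G V) (s : symSq (GroupLieAlgebra I G)) : ℂ :=
  (charP I ρ s).resultant (charP I ρ s).derivative.derivative

end Reps

section Conditions

variable {E : Type*} [NormedAddCommGroup E] [NormedSpace ℝ E]
  {H : Type*} [TopologicalSpace H] (I : ModelWithCorners ℝ E H)
  (G : Type*) [TopologicalSpace G] [ChartedSpace H G] [Group G]

/-- Condition (a): `a_{V,W}` is not the zero polynomial for all irreducible `V`, `W` with
`V ≇ W` and `V* ≇ W`. -/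
def CondA : Prop :=
  ∀ (V W : Type w) [AddCommGroup V] [Module ℂ V] [FiniteDimensional ℂ V]
    [AddCommGroup W] [Module ℂ W] [FiniteDimensional ℂ W]
    (ρ : Representation ℂ G V) (σ : Representation ℂ G W),
    IsIrr I ρ → IsIrr I σ → ¬ Iso ρ σ → ¬ Iso ρ.dual σ → aPoly I ρ σ ≠ 0

/-- Condition (b): `b_V` is not the zero polynomial for all irreducible `V` of real or complex
type. -/
def CondB : Prop :=
  ∀ (V : Type w) [AddCommGroup V] [Module ℂ V] [FiniteDimensional ℂ V]
    (ρ : Representation ℂ G V),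
    IsIrr I ρ → IsRealType ρ ∨ IsComplexType ρ → bPoly I ρ ≠ 0

/-- Condition (c): `c_V` is not the zero polynomial for all irreducible `V` of quaternionic
type. -/
def CondC : Prop :=
  ∀ (V : Type w) [AddCommGroup V] [Module ℂ V] [FiniteDimensional ℂ V]
    (ρ : Representation ℂ G V),
    IsIrr I ρ → IsQuaternionicType ρ → cPoly I ρ ≠ 0

end Conditions

section Products

variable {G G' : Type*} [Group G] [Group G']
  {V : Type*} [AddCommGroup V] [Module ℂ V]
  {V' : Type*} [AddCommGroup V'] [Module ℂ V']

/-- The representation of `G × G'` on `V ⊗ V'` given by `(x, x') ↦ ρ x ⊗ ρ' x'`. -/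
def extTensor (ρ : Representation ℂ G V) (ρ' : Representation ℂ G' V') :
    Representation ℂ (G × G') (V ⊗[ℂ] V') where
  toFun x := TensorProduct.map (ρ x.1) (ρ' x.2)
  map_one' := by simp only [Prod.fst_one, Prod.snd_one, map_one, TensorProduct.map_one]
  map_mul' x y := by simp only [Prod.fst_mul, Prod.snd_mul, map_mul, TensorProduct.map_mul]

end Products

end LieRep

end

noncomputable section

namespace LieRep

/-! ### Spectra of Kronecker sums and generic deformations of their roots -/

section Polynomials

open Polynomial

/-! Over ℂ a resultant is nonzero exactly when the two polynomials have no common root, so each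
condition asks for one `s` with a prescribed spectral property of `D_V(s)`.

Irreducible modules of `G × G'` are the products `V ⊗ V'` (`IsIrr.exists_iso_extTensor`). On `s +
s'`, with `s ∈ Sym²(𝔤)` and `s' ∈ Sym²(𝔤')`, the operator is `D_V(s) ⊗ 1 + 1 ⊗ D_{V'}(s')`
(`symOp_extTensor`), so its eigenvalues are the sums `a + b`. Taking `s' = 0` or `s = 0` transfers
(a) from either factor. For (b) and (c), replace `s'` by `t s'`. If the `a` are simple, then for
small `t` the roots form well separated clusters, each a rescaled copy of the spectrum of
`D_{V'}(s')`. Hence a nonvanishing k-th derivative at the roots survives for generic real `t`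
(`exists_real_iterate_derivative_sumPoly_ne_zero`): k = 1 gives b ⊗ b ⇒ b, and k = 2 gives b ⊗ c ⇒
c.

The rest is bookkeeping of types. By compactness, `V` is self-dual iff it is real or quaternionic
(`iso_dual_iff`). The signs of structure maps multiply, and `V ⊗ V'` is self-dual iff both factors
are. A quaternionic product is therefore real times quaternionic, which proves (c). In (a), only the
pairs with `W ∈ {V, V*}` and `W' ∈ {V', V'*}` are not inherited from a factor; those not excluded by
hypothesis force both factors to be complex. In (b), a product with no quaternionic factor is
automatic, and real times quaternionic is outside the scope of (b), which leaves the listed cases.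
-/

theorem resultant_ne_zero_iff_forall_root {f g : ℂ[X]} (hf : f ≠ 0) :
    f.resultant g ≠ 0 ↔ ∀ z, f.IsRoot z → ¬ g.IsRoot z := by
  rw [Ne, resultant_eq_prod_eval f g _ le_rfl (IsAlgClosed.splits f)]
  simp [hf, Multiset.prod_eq_zero_iff]

open Kronecker in
-- The matrix `z - (A ⊗ 1 + 1 ⊗ B)` is the characteristic matrix of `A` with `z - B` substituted for
-- `X`. Its blocks commute, so its determinant is `det χ_A(z - B)`, which factors over the roots of
-- `χ_A`.
theorem eval_charpoly_kroneckerSum {m n : Type*} [Fintype m] [DecidableEq m] [Fintype n]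
    [DecidableEq n] (A : Matrix m m ℂ) (B : Matrix n n ℂ) (z : ℂ) :
    (A ⊗ₖ (1 : Matrix n n ℂ) + (1 : Matrix m m ℂ) ⊗ₖ B).charpoly.eval z =
      (A.charpoly.roots.map fun a => B.charpoly.eval (z - a)).prod := by
  let f : ℂ[X] →+* Matrix n n ℂ := (aeval (Matrix.scalar n z - B)).toRingHom
  have h := Matrix.det_det A.charmatrix f
  have h1 : (A.charmatrix.map f).comp m m n n ℂ =
      Matrix.scalar (m × n) z - (A ⊗ₖ (1 : Matrix n n ℂ) + (1 : Matrix m m ℂ) ⊗ₖ B) := by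
    ext ⟨i, k⟩ ⟨j, l⟩
    have h2 : f (A.charmatrix i j) k l = ((1 : Matrix m m ℂ) i j) * (Matrix.scalar n z - B) k l -
        A i j * (1 : Matrix n n ℂ) k l := by
      by_cases hij : i = j
      · subst hij
        simp [f, Matrix.charmatrix_apply_eq, Matrix.algebraMap_matrix_apply, Matrix.one_apply]
      · simp [f, Matrix.one_apply, hij,
          Matrix.algebraMap_matrix_apply]
    change f (A.charmatrix i j) k l = _
    rw [h2]
    by_cases hij : i = j <;> by_cases hkl : k = l <;>
      simp [hij, hkl, Matrix.one_apply, Matrix.kroneckerMap_apply]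
    ring
  have hs : A.charpoly = (A.charpoly.roots.map fun a => X - C a).prod :=
    ((IsAlgClosed.splits A.charpoly).eq_prod_roots_of_monic A.charpoly_monic)
  rw [Matrix.eval_charpoly, ← h1, ← h]
  change (f A.charpoly).det = _
  conv_lhs => rw [hs]
  let F : ℂ[X] →* ℂ := Matrix.detMonoidHom.comp f.toMonoidHom
  change F _ = _
  rw [map_multiset_prod, Multiset.map_map]
  congr 1
  refine Multiset.map_congr rfl fun a _ => ?_
  rw [Matrix.eval_charpoly]
  change (f (X - C a)).det = _
  congr 1
  simp [f, Matrix.algebraMap_eq_diagonal, Matrix.scalar_apply]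
  rw [sub_right_comm]
  simp

theorem charpoly_tensorSum {V W : Type*} [AddCommGroup V] [Module ℂ V] [FiniteDimensional ℂ V]
    [AddCommGroup W] [Module ℂ W] [FiniteDimensional ℂ W]
    (A : Module.End ℂ V) (B : Module.End ℂ W) :
    (TensorProduct.map A LinearMap.id + TensorProduct.map LinearMap.id B).charpoly =
      (A.charpoly.roots.map fun a =>
        (B.charpoly.roots.map fun b => X - C (a + b)).prod).prod := by
  let bV := Module.finBasis ℂ V
  let bW := Module.finBasis ℂ W
  refine Polynomial.funext fun z => ?_
  rw [← LinearMap.charpoly_toMatrix _ (bV.tensorProduct bW), map_add, TensorProduct.toMatrix_map,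
    TensorProduct.toMatrix_map, LinearMap.toMatrix_id, LinearMap.toMatrix_id,
    eval_charpoly_kroneckerSum, LinearMap.charpoly_toMatrix, LinearMap.charpoly_toMatrix,
    eval_multiset_prod, Multiset.map_map]
  congr 1
  refine Multiset.map_congr rfl fun a _ => ?_
  have hs : B.charpoly = (B.charpoly.roots.map fun a => X - C a).prod :=
    ((IsAlgClosed.splits B.charpoly).eq_prod_roots_of_monic B.charpoly_monic)
  conv_lhs => rw [hs]
  simp only [Function.comp, eval_multiset_prod, Multiset.map_map]
  congr 1
  refine Multiset.map_congr rfl fun b _ => ?_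
  simp
  ring

theorem roots_charpoly_smul {V : Type*} [AddCommGroup V] [Module ℂ V] [FiniteDimensional ℂ V]
    (A : Module.End ℂ V) {t : ℂ} (ht : t ≠ 0) :
    (t • A).charpoly.roots = A.charpoly.roots.map fun a => t * a := by
  have hs : A.charpoly = (A.charpoly.roots.map fun a => X - C a).prod :=
    ((IsAlgClosed.splits A.charpoly).eq_prod_roots_of_monic A.charpoly_monic)
  have hc : A.charpoly.roots.card = Module.finrank ℂ V := by
    rw [← (IsAlgClosed.splits A.charpoly).natDegree_eq_card_roots, LinearMap.charpoly_natDegree]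
  suffices h : (t • A).charpoly = ((A.charpoly.roots.map fun a => t * a).map
      fun a => X - C a).prod by
    rw [h, roots_multiset_prod_X_sub_C]
  refine Polynomial.funext fun z => ?_
  have h1 : algebraMap ℂ (Module.End ℂ V) z - t • A =
      t • (algebraMap ℂ (Module.End ℂ V) (z / t) - A) := by
    rw [smul_sub, Algebra.algebraMap_eq_smul_one, Algebra.algebraMap_eq_smul_one, smul_smul,
      mul_div_cancel₀ _ ht]
  rw [LinearMap.eval_charpoly, h1, LinearMap.det_smul, ← LinearMap.eval_charpoly, hs, ← hc]
  simp only [eval_multiset_prod, Multiset.map_map, Function.comp]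
  rw [← Multiset.prod_replicate, ← Multiset.map_const', ← Multiset.prod_map_mul]
  congr 1
  rw [← hs]
  refine Multiset.map_congr rfl fun b _ => ?_
  simp [mul_sub, mul_div_cancel₀ _ ht]

theorem iterate_derivative_comp_linear {R : Type*} [CommRing R] (p : R[X]) (a b : R) (k : ℕ) :
    derivative^[k] (p.comp (C a + C b * X)) =
      C (b ^ k) * (derivative^[k] p).comp (C a + C b * X) := by
  induction k with
  | zero => simp
  | succ k ih =>
    rw [Function.iterate_succ_apply', ih, Function.iterate_succ_apply', derivative_C_mul,
      derivative_comp]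
    simp [pow_succ]
    ring

/-- The monic polynomial whose roots are the sums `a + t b` with `a ∈ p` and `b ∈ q`. -/
def sumPoly (p q : Multiset ℂ) (t : ℂ) : ℂ[X] :=
  (p.map fun a => (q.map fun b => X - C (a + t * b)).prod).prod

theorem isRoot_sumPoly {p q : Multiset ℂ} {t z : ℂ} :
    (sumPoly p q t).IsRoot z ↔ ∃ a ∈ p, ∃ b ∈ q, z = a + t * b := by
  simp [sumPoly, IsRoot, eval_multiset_prod, Multiset.prod_eq_zero_iff, Multiset.mem_map,
    sub_eq_zero]

/-- Zoom in on the cluster at `a` by substituting `X ↦ a + t X`. After division by a power of `t`,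
the polynomial tends, as `t → 0`, to a constant times the polynomial of `q`; the constant is nonzero
because `a` is simple in `p`. The k-th derivative at `b` is polynomial in `t` and nonzero at `t =
0`: this is `g`. -/
theorem exists_poly_eval_iterate_derivative_sumPoly {p q : Multiset ℂ} {k : ℕ} (hp : p.Nodup)
    {a b : ℂ} (ha : a ∈ p)
    (hb : (derivative^[k] (q.map fun b => X - C b).prod).eval b ≠ 0) :
    ∃ g : ℂ[X], g ≠ 0 ∧ ∀ t : ℂ, t ≠ 0 → g.eval t ≠ 0 →
      (derivative^[k] (sumPoly p q t)).eval (a + t * b) ≠ 0 := by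
  obtain ⟨m, rfl⟩ := Multiset.exists_cons_of_mem ha
  have ham : a ∉ m := (Multiset.nodup_cons.1 hp).1
  -- The rescaled polynomial, with `t` as the inner variable: the factor `c = a` gives the
  -- polynomial of `q`, and each other root `c` gives the factors `a - c + t (X - b)`.
  let Q : ℂ[X][X] := ((q.map fun b => X - C b).prod).map C *
    (m.map fun c => (q.map fun b => C (C (a - c)) + C X * (X - C (C b))).prod).prod
  have hQ : ∀ t, (eval (C b) (derivative^[k] Q)).eval t =
      (derivative^[k] (Q.map (evalRingHom t))).eval b := by
    intro t
    rw [iterate_derivative_map, eval_map, ← coe_evalRingHom t, ← eval₂_at_apply, coe_evalRingHom,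
      eval_C]
  have hQt : ∀ t, Q.map (evalRingHom t) = (q.map fun b => X - C b).prod *
      (m.map fun c => (q.map fun b => C (a - c) + C t * (X - C b)).prod).prod := by
    intro t
    simp only [Q, Polynomial.map_mul, 
      Polynomial.map_multiset_prod, Multiset.map_map, Function.comp_def, Polynomial.map_add,
      Polynomial.map_sub, Polynomial.map_X, Polynomial.map_C, coe_evalRingHom, eval_X, eval_C]
  refine ⟨eval (C b) (derivative^[k] Q), fun h0 => ?_, fun t ht hg hd => hg ?_⟩
  -- At `t = 0` the second factor is a constant, a product of differences `a - c ≠ 0`.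
  · have h1 := hQ 0
    rw [h0, hQt] at h1
    have h2 : (m.map fun c => (q.map fun b => C (a - c) + C (0 : ℂ) * (X - C b)).prod).prod =
        C ((m.map fun c => (q.map fun _ => a - c).prod).prod) := by
      simp [map_multiset_prod, Multiset.map_map]
    rw [h2, mul_comm, iterate_derivative_C_mul, eval_mul, eval_zero, eval_C, eq_comm,
      mul_eq_zero] at h1
    refine hb (h1.resolve_left fun h3 => ?_)
    rw [Multiset.prod_eq_zero_iff] at h3
    obtain ⟨c, hc, h4⟩ := Multiset.mem_map.1 h3
    rw [Multiset.prod_eq_zero_iff] at h4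
    obtain ⟨d, -, h5⟩ := Multiset.mem_map.1 h4
    exact ham (by rwa [sub_eq_zero.1 h5])
  · have hF : (sumPoly (a ::ₘ m) q t).comp (C a + C t * X) =
        C (t ^ Multiset.card q) * Q.map (evalRingHom t) := by
      rw [hQt, sumPoly, Multiset.map_cons, Multiset.prod_cons, mul_comp, ← mul_assoc]
      congr 1
      · rw [multiset_prod_comp, Multiset.map_map, C_pow, ← Multiset.prod_replicate,
          ← Multiset.map_const', ← Multiset.prod_map_mul]
        congr 1
        refine Multiset.map_congr rfl fun b _ => ?_
        simp
        ring
      · simp only [multiset_prod_comp, Multiset.map_map, Function.comp_def]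
        congr 1
        refine Multiset.map_congr rfl fun c _ => ?_
        congr 1
        refine Multiset.map_congr rfl fun b _ => ?_
        simp
        ring
    have h1 := congrArg (fun r => eval b (derivative^[k] r)) hF
    simp only [iterate_derivative_comp_linear, iterate_derivative_C_mul, eval_mul, eval_C,
      eval_comp, eval_add, eval_X, hd, mul_zero] at h1
    rw [hQ]
    exact (mul_eq_zero.1 h1.symm).resolve_left (pow_ne_zero _ ht)

/-- Each of the finitely many pairs `(a, b)` excludes only finitely many `t`. The parameter must be
real because it scales an element of the real space `Sym²(𝔤)`. -/
theorem exists_real_iterate_derivative_sumPoly_ne_zero {p q : Multiset ℂ} {k : ℕ} (hp : p.Nodup)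
    (hq : ∀ b ∈ q, (derivative^[k] (q.map fun b => X - C b).prod).eval b ≠ 0) :
    ∃ t : ℝ, t ≠ 0 ∧ ∀ z, (sumPoly p q t).IsRoot z →
      ¬ (derivative^[k] (sumPoly p q t)).IsRoot z := by
  have h : ∀ c : ℂ × ℂ, ∃ g : ℂ[X], g ≠ 0 ∧ (c ∈ p ×ˢ q → ∀ t : ℂ, t ≠ 0 → g.eval t ≠ 0 →
      (derivative^[k] (sumPoly p q t)).eval (c.1 + t * c.2) ≠ 0) := by
    intro c
    by_cases hc : c ∈ p ×ˢ q
    · obtain ⟨g, hg, h⟩ := exists_poly_eval_iterate_derivative_sumPoly hp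
        (Multiset.mem_product.1 hc).1 (hq _ (Multiset.mem_product.1 hc).2)
      exact ⟨g, hg, fun _ => h⟩
    · exact ⟨1, one_ne_zero, fun h => absurd h hc⟩
  choose g hg0 hg using h
  -- The factor `X` enforces `t ≠ 0`.
  let r : ℂ[X] := X * ∏ c ∈ (p ×ˢ q).toFinset, g c
  have hr : r ≠ 0 := mul_ne_zero X_ne_zero (Finset.prod_ne_zero_iff.2 fun c _ => hg0 c)
  obtain ⟨t, ht⟩ : ∃ t : ℝ, r.eval (t : ℂ) ≠ 0 := by
    by_contra! hc
    refine hr (eq_zero_of_infinite_isRoot r ?_)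
    exact (Set.infinite_range_of_injective Complex.ofReal_injective).mono
      (by rintro _ ⟨t, rfl⟩; exact hc t)
  simp only [r, eval_mul, eval_X, eval_prod] at ht
  have ht0 := left_ne_zero_of_mul ht
  refine ⟨t, by simpa using ht0, fun z hz => ?_⟩
  obtain ⟨a, ha, b, hb, rfl⟩ := isRoot_sumPoly.1 hz
  have hm : (a, b) ∈ p ×ˢ q := Multiset.mem_product.2 ⟨ha, hb⟩
  exact hg (a, b) hm t ht0 (Finset.prod_ne_zero_iff.1 (right_ne_zero_of_mul ht) (a, b)
    (Multiset.mem_toFinset.2 hm))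

theorem nodup_roots_of_derivative {f : ℂ[X]} (h : ∀ z, f.IsRoot z → ¬ (derivative f).IsRoot z) :
    f.roots.Nodup := by
  by_cases hf : f = 0
  · simp [hf]
  rw [Multiset.nodup_iff_count_le_one]
  intro z
  rw [count_roots]
  by_contra! hz
  obtain ⟨h1, h2⟩ := (one_lt_rootMultiplicity_iff_isRoot hf).1 hz
  exact h z h1 h2

end Polynomials

/-! ### Schur's lemma, duals and Burnside's theorem -/

section RepresentationTheory

variable {G : Type*} [Group G] {V : Type*} [AddCommGroup V] [Module ℂ V]
  {W : Type*} [AddCommGroup W] [Module ℂ W] {U : Type*} [AddCommGroup U] [Module ℂ U]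
  {ρ : Representation ℂ G V} {σ : Representation ℂ G W} {τ : Representation ℂ G U}

theorem iso_iff : Iso ρ σ ↔ ∃ e : V ≃ₗ[ℂ] W, ∀ x v, e (ρ x v) = σ x (e v) := by
  constructor
  · rintro ⟨e⟩
    exact ⟨e.toLinearEquiv, fun x v =>
      Representation.IntertwiningMap.isIntertwining ρ σ e.toIntertwiningMap x v⟩
  · rintro ⟨e, he⟩
    exact ⟨.mk e fun x => LinearMap.ext (he x)⟩

theorem Iso.refl (ρ : Representation ℂ G V) : Iso ρ ρ := ⟨.refl ρ⟩

theorem Iso.symm : Iso ρ σ → Iso σ ρ := fun ⟨e⟩ => ⟨Representation.Equiv.symm e⟩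

theorem Iso.trans : Iso ρ σ → Iso σ τ → Iso ρ τ := fun ⟨e⟩ ⟨f⟩ => ⟨e.trans f⟩

theorem Iso.dual (h : Iso ρ σ) : Iso ρ.dual σ.dual := by
  obtain ⟨e, he⟩ := iso_iff.1 h
  refine Iso.symm (iso_iff.2 ⟨e.dualMap, fun x φ => LinearMap.ext fun v => ?_⟩)
  simp [Representation.dual_apply, Module.Dual.transpose_apply, he]

theorem isIrreducible_iff : ρ.IsIrreducible ↔ Nontrivial V ∧ ∀ N : Submodule ℂ V,
    (∀ x, ∀ v ∈ N, ρ x v ∈ N) → N ≠ ⊥ → N = ⊤ := by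
  constructor
  · intro h
    refine ⟨?_, fun N hN h0 => ?_⟩
    · by_contra hn
      rw [not_nontrivial_iff_subsingleton] at hn
      obtain ⟨a, b, hab⟩ := h.toNontrivial
      exact hab (Subrepresentation.toSubmodule_injective (Subsingleton.elim _ _))
    · rcases h.eq_bot_or_eq_top ⟨N, fun g v hv => hN g v hv⟩ with h1 | h1
      · exact absurd (congrArg Subrepresentation.toSubmodule h1) h0
      · exact congrArg Subrepresentation.toSubmodule h1
  · rintro ⟨h1, h2⟩
    refine { exists_pair_ne := ⟨⊥, ⊤, fun h => ?_⟩, eq_bot_or_eq_top := fun N => ?_ }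
    · exact bot_ne_top (α := Submodule ℂ V) (congrArg Subrepresentation.toSubmodule h)
    · by_cases h0 : N.toSubmodule = ⊥
      · exact Or.inl (Subrepresentation.toSubmodule_injective h0)
      · exact Or.inr (Subrepresentation.toSubmodule_injective
          (h2 _ (fun x v hv => N.apply_mem_toSubmodule x hv) h0))

theorem injective_of_irreducible (hρ : ρ.IsIrreducible) {f : V →ₗ[ℂ] W} (hf : f ≠ 0)
    (h : ∀ x v, f (ρ x v) = σ x (f v)) : Function.Injective f := by
  rw [← LinearMap.ker_eq_bot]
  by_contra h0
  refine hf (LinearMap.ker_eq_top.1 ((isIrreducible_iff.1 hρ).2 _ (fun x v hv => ?_) h0))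
  rw [LinearMap.mem_ker] at hv ⊢
  rw [h, hv, map_zero]

theorem bijective_of_irreducible (hρ : ρ.IsIrreducible) (hσ : σ.IsIrreducible) {f : V →ₗ[ℂ] W}
    (hf : f ≠ 0) (h : ∀ x v, f (ρ x v) = σ x (f v)) : Function.Bijective f := by
  refine ⟨injective_of_irreducible hρ hf h, LinearMap.range_eq_top.1 ?_⟩
  refine (isIrreducible_iff.1 hσ).2 _ ?_ fun h0 => hf (LinearMap.range_eq_bot.1 h0)
  rintro x _ ⟨v, rfl⟩
  exact ⟨ρ x v, h x v⟩

theorem iso_of_ne_zero (hρ : ρ.IsIrreducible) (hσ : σ.IsIrreducible) {f : V →ₗ[ℂ] W}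
    (hf : f ≠ 0) (h : ∀ x v, f (ρ x v) = σ x (f v)) : Iso ρ σ :=
  iso_iff.2 ⟨LinearEquiv.ofBijective f (bijective_of_irreducible hρ hσ hf h), h⟩

theorem exists_eq_smul_of_irreducible [FiniteDimensional ℂ V] (hρ : ρ.IsIrreducible)
    {f : V →ₗ[ℂ] V} (h : ∀ x v, f (ρ x v) = ρ x (f v)) : ∃ c : ℂ, ∀ v, f v = c • v := by
  have := (isIrreducible_iff.1 hρ).1
  obtain ⟨c, hc⟩ := Module.End.exists_eigenvalue f
  refine ⟨c, fun v => ?_⟩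
  have h1 := (isIrreducible_iff.1 hρ).2 (Module.End.eigenspace f c) (fun x v hv => ?_) hc
  · have : v ∈ Module.End.eigenspace f c := h1 ▸ Submodule.mem_top
    exact Module.End.mem_eigenspace_iff.1 this
  · rw [Module.End.mem_eigenspace_iff] at hv ⊢
    rw [h, hv, map_smul]

theorem Iso.irreducible (h : Iso ρ σ) (hρ : ρ.IsIrreducible) : σ.IsIrreducible := by
  obtain ⟨e, he⟩ := iso_iff.1 h
  have := (isIrreducible_iff.1 hρ).1
  refine isIrreducible_iff.2 ⟨e.symm.toEquiv.nontrivial, fun N hN h0 => ?_⟩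
  have h1 := (isIrreducible_iff.1 hρ).2 (N.comap e.toLinearMap)
    (fun x v hv => by
      simp only [Submodule.mem_comap, LinearEquiv.coe_coe] at hv ⊢
      rw [he]; exact hN x _ hv) (fun h2 => h0 ?_)
  · rw [eq_top_iff]
    intro w _
    have : e.symm w ∈ N.comap e.toLinearMap := h1 ▸ Submodule.mem_top
    simpa using this
  · rw [eq_bot_iff]
    intro w hw
    have : e.symm w ∈ N.comap e.toLinearMap := by simpa using hw
    rw [h2] at this
    simpa using this

/-- An invariant subspace of the dual is the annihilator of its coannihilator, which is invariant in
`V`. -/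
theorem irreducible_dual [FiniteDimensional ℂ V] (hρ : ρ.IsIrreducible) :
    ρ.dual.IsIrreducible := by
  have := (isIrreducible_iff.1 hρ).1
  refine isIrreducible_iff.2 ⟨inferInstance, fun N hN h0 => ?_⟩
  by_contra h1
  have h2 : N.dualCoannihilator ≠ ⊥ := fun h => h1 (by
    rw [← Subspace.dualCoannihilator_dualAnnihilator_eq (W := N), h,
      Submodule.dualAnnihilator_bot])
  have h3 := (isIrreducible_iff.1 hρ).2 _ (fun x v hv => ?_) h2
  · exact h0 (by
      rw [← Subspace.dualCoannihilator_dualAnnihilator_eq (W := N), h3,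
        Submodule.dualAnnihilator_top])
  · rw [Submodule.mem_dualCoannihilator] at hv ⊢
    intro φ hφ
    have := hv _ (hN x⁻¹ φ hφ)
    simpa [Representation.dual_apply, Module.Dual.transpose_apply] using this

/-- A nonzero finite dimensional representation has an irreducible subrepresentation. -/
theorem exists_irreducible_subrepresentation [FiniteDimensional ℂ V] [Nontrivial V]
    (ρ : Representation ℂ G V) : ∃ N : Subrepresentation ρ, N.toRepresentation.IsIrreducible := by
  obtain ⟨N, ⟨hN, hN0⟩, hmin⟩ := WellFounded.has_min (wellFounded_lt (α := Submodule ℂ V))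
    {N | (∀ x, ∀ v ∈ N, ρ x v ∈ N) ∧ N ≠ ⊥} ⟨⊤, fun _ _ _ => trivial, top_ne_bot⟩
  refine ⟨⟨N, fun x v hv => hN x v hv⟩, isIrreducible_iff.2
    ⟨Submodule.nontrivial_iff_ne_bot.2 hN0, fun M hM hM0 => ?_⟩⟩
  have h1 := hmin (M.map N.subtype) ⟨?_, fun h => hM0 ?_⟩
  · have h2 : M.map N.subtype = N :=
      eq_of_le_of_not_lt (Submodule.map_subtype_le N M) h1
    rw [eq_top_iff]
    rintro ⟨v, hv⟩ -
    obtain ⟨m, hm, hmv⟩ : v ∈ M.map N.subtype := by rw [h2]; exact hv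
    have : m = ⟨v, hv⟩ := Subtype.ext hmv
    exact this ▸ hm
  · rintro x _ ⟨m, hm, rfl⟩
    exact ⟨_, hM x m hm, rfl⟩
  · exact Submodule.map_injective_of_injective N.subtype_injective 
      (h.trans (Submodule.map_bot _).symm)

/-- Burnside's theorem: an irreducible representation spans the endomorphism algebra. -/
theorem span_range_eq_top [FiniteDimensional ℂ V] (hρ : ρ.IsIrreducible) :
    Submodule.span ℂ (Set.range ρ) = ⊤ := by
  rw [eq_top_iff]
  intro f _
  have : ρ.IsIrreducible := hρ
  -- By Schur the commutant consists of scalars, so every linear `f` commutes with it. Jacobson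
  -- density on a basis then realises `f` by an element of the group algebra.
  let F : Module.End (Module.End (MonoidAlgebra ℂ G) ρ.asModule) ρ.asModule :=
    { toFun := f
      map_add' := f.map_add
      map_smul' := fun φ m => by
        let ψ := (Representation.IntertwiningMap.equivLinearMapAsModule ρ ρ).symm φ
        obtain ⟨c, hc⟩ := exists_eq_smul_of_irreducible hρ (f := ψ.toLinearMap)
          (fun x v => Representation.IntertwiningMap.isIntertwining ρ ρ ψ x v)
        have h1 : ∀ v : V, f (ψ.toLinearMap v) = ψ.toLinearMap (f v) := fun v => by
          rw [hc, hc, map_smul]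
        exact h1 m }
  classical
  obtain ⟨r, hr⟩ := jacobson_density F (Finset.univ.image (Module.finBasis ℂ V))
  have h1 : f = ρ.asAlgebraHom r := by
    refine (Module.finBasis ℂ V).ext fun i => ?_
    exact hr _ (Finset.mem_image_of_mem _ (Finset.mem_univ i))
  rw [h1]
  clear hr h1
  induction r using MonoidAlgebra.induction_linear with
  | zero => simp
  | add a b ha hb => rw [map_add]; exact add_mem ha hb
  | single g a =>
    rw [Representation.asAlgebraHom_single]
    exact Submodule.smul_mem _ _ (Submodule.subset_span ⟨g, rfl⟩)

end RepresentationTheory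

/-! ### Exterior tensor products: irreducibility and uniqueness of the factors -/

section ExteriorTensor

variable {G G' : Type*} [Group G] [Group G']
  {V : Type*} [AddCommGroup V] [Module ℂ V] {V' : Type*} [AddCommGroup V'] [Module ℂ V']
  {W : Type*} [AddCommGroup W] [Module ℂ W] {W' : Type*} [AddCommGroup W'] [Module ℂ W']
  {ρ : Representation ℂ G V} {ρ' : Representation ℂ G' V'}
  {σ : Representation ℂ G W} {σ' : Representation ℂ G' W'}

@[simp]
theorem extTensor_apply_tmul (x : G × G') (v : V) (v' : V') :
    extTensor ρ ρ' x (v ⊗ₜ[ℂ] v') = ρ x.1 v ⊗ₜ[ℂ] ρ' x.2 v' := rfl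

theorem Iso.extTensor (h : Iso ρ σ) (h' : Iso ρ' σ') : Iso (extTensor ρ ρ') (extTensor σ σ') := by
  obtain ⟨e, he⟩ := iso_iff.1 h
  obtain ⟨e', he'⟩ := iso_iff.1 h'
  refine iso_iff.2 ⟨TensorProduct.congr e e', fun x t => ?_⟩
  induction t with
  | zero => simp
  | add a b ha hb => simp only [map_add, ha, hb]
  | tmul v v' => simp [he, he']

theorem iso_dual_extTensor [FiniteDimensional ℂ V] [FiniteDimensional ℂ V'] :
    Iso (extTensor ρ.dual ρ'.dual) (LieRep.extTensor ρ ρ').dual := by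
  refine iso_iff.2 ⟨TensorProduct.dualDistribEquiv ℂ V V', fun x t => ?_⟩
  induction t with
  | zero => simp
  | add a b ha hb => simp only [map_add, ha, hb]
  | tmul φ φ' =>
    refine TensorProduct.ext' fun v v' => ?_
    simp [TensorProduct.dualDistribEquiv, TensorProduct.dualDistribEquivOfBasis,
      Representation.dual_apply, Module.Dual.transpose_apply]

/-- By Burnside an invariant subspace is stable under every `A ⊗ B`. Rank one `A` and `B` carry a
nonzero vector to a nonzero multiple of any pure tensor. -/
theorem irreducible_extTensor [FiniteDimensional ℂ V] [FiniteDimensional ℂ V']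
    (hρ : ρ.IsIrreducible) (hρ' : ρ'.IsIrreducible) : (extTensor ρ ρ').IsIrreducible := by
  have := (isIrreducible_iff.1 hρ).1
  have := (isIrreducible_iff.1 hρ').1
  refine isIrreducible_iff.2 ⟨inferInstance, fun N hN h0 => ?_⟩
  have hmap : ∀ (A : Module.End ℂ V) (B : Module.End ℂ V'), ∀ w ∈ N,
      TensorProduct.map A B w ∈ N := by
    intro A B w hw
    have hA : A ∈ Submodule.span ℂ (Set.range ρ) := by rw [span_range_eq_top hρ]; trivial
    have hB : B ∈ Submodule.span ℂ (Set.range ρ') := by rw [span_range_eq_top hρ']; trivial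
    induction hA using Submodule.span_induction with
    | zero => simp
    | add a b _ _ ha hb =>
      rw [TensorProduct.map_add_left]; exact add_mem ha hb
    | smul c a _ ha => rw [TensorProduct.map_smul_left]; exact N.smul_mem c ha
    | mem a ha =>
      obtain ⟨x, rfl⟩ := ha
      induction hB using Submodule.span_induction with
      | zero => simp
      | add a b _ _ ha hb =>
        rw [TensorProduct.map_add_right]; exact add_mem ha hb
      | smul c a _ ha => rw [TensorProduct.map_smul_right]; exact N.smul_mem c ha
      | mem b hb =>
        obtain ⟨x', rfl⟩ := hb
        exact hN (x, x') w hw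
  obtain ⟨w, hw, hw0⟩ := N.exists_mem_ne_zero_of_ne_bot h0
  let b := Module.finBasis ℂ V
  let b' := Module.finBasis ℂ V'
  obtain ⟨⟨i, j⟩, hij⟩ : ∃ i, (b.tensorProduct b').repr w i ≠ 0 := by
    by_contra! h
    exact hw0 ((b.tensorProduct b').repr.map_eq_zero_iff.1 (Finsupp.ext h))
  have hpure : ∀ v v', v ⊗ₜ[ℂ] v' ∈ N := by
    intro v v'
    have h1 := hmap ((b.coord i).smulRight v) ((b'.coord j).smulRight v') w hw
    have h2 : ∀ t, TensorProduct.map ((b.coord i).smulRight v) ((b'.coord j).smulRight v') t =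
        (b.tensorProduct b').repr t (i, j) • (v ⊗ₜ[ℂ] v') := by
      intro t
      induction t with
      | zero => simp
      | add x y hx hy => simp only [map_add, hx, hy, Finsupp.add_apply, add_smul]
      | tmul x y => simp [TensorProduct.smul_tmul', smul_smul, mul_comm]
    rw [h2] at h1
    exact (N.smul_mem_iff hij).1 h1
  rw [eq_top_iff, ← TensorProduct.span_tmul_eq_top, Submodule.span_le]
  rintro _ ⟨v, v', rfl⟩
  exact hpure v v'

/-- Fixing `v'` in the source and contracting `W'` with a coordinate form turns the isomorphism into
a `G`-map `V → W`. For suitable choices it is nonzero, and Schur applies. -/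
theorem iso_left_of_iso_extTensor [FiniteDimensional ℂ W] [FiniteDimensional ℂ W']
    (hρ : ρ.IsIrreducible) (hρ' : ρ'.IsIrreducible)
    (hσ : σ.IsIrreducible) (h : Iso (extTensor ρ ρ') (extTensor σ σ')) : Iso ρ σ := by
  obtain ⟨e, he⟩ := iso_iff.1 h
  have := (isIrreducible_iff.1 hρ).1
  have := (isIrreducible_iff.1 hρ').1
  obtain ⟨v, v', hne⟩ : ∃ v v', e (v ⊗ₜ[ℂ] v') ≠ 0 := by
    by_contra! h0
    obtain ⟨t, ht⟩ := exists_ne (0 : V ⊗[ℂ] V')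
    have h1 : e.toLinearMap = 0 := TensorProduct.ext' h0
    exact ht (e.map_eq_zero_iff.1 (LinearMap.congr_fun h1 t))
  let a := Module.finBasis ℂ W
  let b := Module.finBasis ℂ W'
  obtain ⟨⟨j, i⟩, hji⟩ : ∃ i, (a.tensorProduct b).repr (e (v ⊗ₜ[ℂ] v')) i ≠ 0 := by
    by_contra! h
    exact hne ((a.tensorProduct b).repr.map_eq_zero_iff.1 (Finsupp.ext h))
  have hi : TensorProduct.rid ℂ W (TensorProduct.map LinearMap.id (b.coord i)
      (e (v ⊗ₜ[ℂ] v'))) ≠ 0 := by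
    intro h0
    have h1 : ∀ t, (a.tensorProduct b).repr t (j, i) =
        a.repr (TensorProduct.rid ℂ W (TensorProduct.map LinearMap.id (b.coord i) t)) j := by
      intro t
      induction t with
      | zero => simp
      | add x y hx hy => simp only [map_add, hx, hy, Finsupp.add_apply]
      | tmul x y => simp [mul_comm]
    rw [h1, h0] at hji
    simp at hji
  refine iso_of_ne_zero hρ hσ (f := (TensorProduct.rid ℂ W).toLinearMap ∘ₗ
    TensorProduct.map LinearMap.id (b.coord i) ∘ₗ e.toLinearMap ∘ₗ
      (TensorProduct.mk ℂ V V').flip v') (fun h0 => hi (LinearMap.congr_fun h0 v)) fun x u => ?_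
  have h1 := he (x, 1) (u ⊗ₜ v')
  simp only [extTensor_apply_tmul, map_one, Module.End.one_apply] at h1
  simp only [LinearMap.comp_apply, LinearEquiv.coe_coe, LinearMap.flip_apply,
    TensorProduct.mk_apply, h1]
  generalize e (u ⊗ₜ v') = t
  induction t with
  | zero => simp
  | add a b ha hb => simp only [map_add, ha, hb]
  | tmul a a' => simp

end ExteriorTensor

/-! ### Structure maps and self-duality -/

section Types

variable {G : Type*} [Group G] {V : Type*} [AddCommGroup V] [Module ℂ V]
  {W : Type*} [AddCommGroup W] [Module ℂ W]
  {ρ : Representation ℂ G V} {σ : Representation ℂ G W}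

/-- There is a conjugate linear `G`-map `J` with `J² = ε`. -/
def HasStructureMap (ρ : Representation ℂ G V) (ε : ℂ) : Prop :=
  ∃ J : V →ₛₗ[starRingEnd ℂ] V, (∀ x v, J (ρ x v) = ρ x (J v)) ∧ ∀ v, J (J v) = ε • v

theorem isRealType_iff : IsRealType ρ ↔ HasStructureMap ρ 1 := by
  simp [IsRealType, HasStructureMap]

theorem isQuaternionicType_iff : IsQuaternionicType ρ ↔ HasStructureMap ρ (-1) := by
  simp [IsQuaternionicType, HasStructureMap]

theorem HasStructureMap.iso {ε : ℂ} (h : Iso ρ σ) : HasStructureMap ρ ε → HasStructureMap σ ε := by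
  rintro ⟨J, hJ, hJ2⟩
  obtain ⟨e, he⟩ := iso_iff.1 h
  refine ⟨(e.toLinearMap.comp J).comp e.symm.toLinearMap, fun x w => ?_, fun w => ?_⟩
  · have : e.symm (σ x w) = ρ x (e.symm w) := by
      rw [LinearEquiv.symm_apply_eq, he, LinearEquiv.apply_symm_apply]
    simp [this, hJ, he]
  · simp [hJ2]

theorem HasStructureMap.extTensor {G' : Type*} [Group G'] {V' : Type*} [AddCommGroup V']
    [Module ℂ V'] {ρ' : Representation ℂ G' V'} {ε ε' : ℂ} :
    HasStructureMap ρ ε → HasStructureMap ρ' ε' →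
      HasStructureMap (LieRep.extTensor ρ ρ') (ε * ε') := by
  rintro ⟨J, hJ, hJ2⟩ ⟨J', hJ', hJ2'⟩
  refine ⟨TensorProduct.map J J', fun x t => ?_, fun t => ?_⟩
  · induction t with
    | zero => simp
    | add a b ha hb => simp only [map_add, ha, hb]
    | tmul v v' => simp [hJ, hJ']
  · induction t with
    | zero => simp
    | add a b ha hb => simp only [map_add, ha, hb, smul_add]
    | tmul v v' => simp [hJ2, hJ2', TensorProduct.smul_tmul', smul_smul, mul_comm]

/-- By Schur `J K = c`, so `K` is `conj c • J` and `K² = |c|²`, which cannot be `-1`. -/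
theorem not_real_and_quaternionic [FiniteDimensional ℂ V] (hρ : ρ.IsIrreducible) :
    ¬ (IsRealType ρ ∧ IsQuaternionicType ρ) := by
  rintro ⟨⟨J, hJ, hJ2⟩, ⟨K, hK, hK2⟩⟩
  have := (isIrreducible_iff.1 hρ).1
  obtain ⟨v, hv⟩ := exists_ne (0 : V)
  obtain ⟨c, hc⟩ := exists_eq_smul_of_irreducible hρ (f := J.comp K)
    (fun x v => by simp [hJ, hK])
  have h1 : ∀ v, J (K v) = c • v := hc
  have h2 : ∀ v, K v = starRingEnd ℂ c • J v := fun v => by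
    rw [← map_smulₛₗ, ← h1, hJ2]
  have h3 : K (K v) = (c * starRingEnd ℂ c) • v := by
    rw [h2 (K v), h1, smul_smul, mul_comm]
  rw [hK2, ← neg_one_smul ℂ v] at h3
  have h4 := smul_left_injective ℂ hv h3
  rw [Complex.mul_conj] at h4
  have h5 := congrArg Complex.re h4
  simp at h5
  linarith [Complex.normSq_nonneg c]

/-- Composing `e` with a linear isomorphism `V* ≅ V` gives a conjugate linear `G`-map `J` with `J² =
c` by Schur. Here `c` is real and nonzero, so scaling by `|c|^(-1/2)` makes it `±1`. Conversely, `e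
∘ J` is a linear `G`-map `V → V*`. -/
theorem iso_dual_iff_of_conj [FiniteDimensional ℂ V] (hρ : ρ.IsIrreducible)
    (e : V ≃ₛₗ[starRingEnd ℂ] Module.Dual ℂ V) (he : ∀ x v, e (ρ x v) = ρ.dual x (e v)) :
    Iso ρ.dual ρ ↔ IsRealType ρ ∨ IsQuaternionicType ρ := by
  have := (isIrreducible_iff.1 hρ).1
  constructor
  · intro h
    obtain ⟨ψ, hψ⟩ := iso_iff.1 h
    let J : V →ₛₗ[starRingEnd ℂ] V := ψ.toLinearMap.comp e.toLinearMap
    have hJ : ∀ x v, J (ρ x v) = ρ x (J v) := fun x v => by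
      change ψ (e (ρ x v)) = ρ x (ψ (e v))
      rw [he, hψ]
    have hJ0 : ∀ v, J v = 0 → v = 0 := fun v hv => by simpa [J] using hv
    obtain ⟨c, hc⟩ := exists_eq_smul_of_irreducible hρ (f := J.comp J)
      (fun x v => by simp [hJ])
    have hc' : ∀ v, J (J v) = c • v := hc
    obtain ⟨v, hv⟩ := exists_ne (0 : V)
    have hJv : J v ≠ 0 := fun h => hv (hJ0 v h)
    -- Compare `J (J² v)` with `J² (J v)`; conjugate linearity puts a bar on one side.
    have h1 : starRingEnd ℂ c = c := by
      have h2 := hc' (J v)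
      rw [hc' v, map_smulₛₗ] at h2
      exact smul_left_injective ℂ hJv h2
    obtain ⟨r, rfl⟩ := Complex.conj_eq_iff_real.1 h1
    have hr0 : r ≠ 0 := fun h => hJv (hJ0 _ (by rw [hc', h]; simp))
    have hs : 0 < |r| := abs_pos.2 hr0
    have hK : ∀ v, (((√|r|)⁻¹ : ℝ) : ℂ) • J ((((√|r|)⁻¹ : ℝ) : ℂ) • J v) =
        ((r / |r| : ℝ) : ℂ) • v := fun v => by
      rw [map_smulₛₗ, hc', smul_smul, smul_smul, Complex.conj_ofReal, ← Complex.ofReal_mul,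
        ← Complex.ofReal_mul, ← mul_inv, Real.mul_self_sqrt hs.le, inv_mul_eq_div]
    rcases lt_or_gt_of_ne hr0 with h | h
    · refine Or.inr (isQuaternionicType_iff.2 ⟨(((√|r|)⁻¹ : ℝ) : ℂ) • J, fun x v => ?_, fun v => ?_⟩)
      · simp [hJ]
      · have := hK v
        rw [abs_of_neg h, div_neg, div_self hr0] at this
        simpa [abs_of_neg h] using this
    · refine Or.inl (isRealType_iff.2 ⟨(((√|r|)⁻¹ : ℝ) : ℂ) • J, fun x v => ?_, fun v => ?_⟩)
      · simp [hJ]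
      · have := hK v
        rw [abs_of_pos h, div_self hr0] at this
        simpa [abs_of_pos h] using this
  · have key : ∀ ε : ℂ, ε ≠ 0 → HasStructureMap ρ ε → Iso ρ.dual ρ := by
      rintro ε hε ⟨J, hJ, hJ2⟩
      refine Iso.symm (iso_of_ne_zero hρ (irreducible_dual hρ) (f := e.toLinearMap.comp J)
        (fun h0 => ?_) fun x v => by simp [hJ, he])
      obtain ⟨v, hv⟩ := exists_ne (0 : V)
      have h1 : e (J (J v)) = 0 := LinearMap.congr_fun h0 (J v)
      rw [hJ2] at h1
      exact smul_ne_zero hε hv (e.map_eq_zero_iff.1 h1)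
    rintro (h | h)
    · exact key 1 one_ne_zero (isRealType_iff.1 h)
    · exact key (-1) (by simp) (isQuaternionicType_iff.1 h)

end Types

/-! ### Smoothness, and classification of the irreducible modules of a product -/

section Smoothness

variable {E : Type*} [NormedAddCommGroup E] [NormedSpace ℝ E]
  {H : Type*} [TopologicalSpace H] {I : ModelWithCorners ℝ E H}
  {G : Type*} [TopologicalSpace G] [ChartedSpace H G] [Group G]
  {E' : Type*} [NormedAddCommGroup E'] [NormedSpace ℝ E']
  {H' : Type*} [TopologicalSpace H'] {I' : ModelWithCorners ℝ E' H'}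
  {G' : Type*} [TopologicalSpace G'] [ChartedSpace H' G'] [Group G']
  {V : Type*} [AddCommGroup V] [Module ℂ V] {V' : Type*} [AddCommGroup V'] [Module ℂ V']
  {W : Type*} [AddCommGroup W] [Module ℂ W]
  {ρ : Representation ℂ G V} {σ : Representation ℂ G W} {ρ' : Representation ℂ G' V'}

/-- A linear form on `V` extends to `W` through a left inverse of `j`, so matrix coefficients of `ρ`
are among those of `σ`. -/
theorem IsSmooth.of_injective (hσ : IsSmooth I σ) {j : V →ₗ[ℂ] W} (hj : Function.Injective j)
    (h : ∀ x v, j (ρ x v) = σ x (j v)) : IsSmooth I ρ := by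
  intro v φ
  obtain ⟨l, hl⟩ := j.exists_leftInverse_of_injective (LinearMap.ker_eq_bot.2 hj)
  have h1 : (fun x => φ (ρ x v)) = fun x => (φ ∘ₗ l) (σ x (j v)) := by
    funext x
    rw [← h, LinearMap.comp_apply, ← LinearMap.comp_apply l j, hl, LinearMap.id_apply]
  rw [h1]
  exact hσ _ _

theorem Iso.isSmooth (h : Iso ρ σ) (hσ : IsSmooth I σ) : IsSmooth I ρ := by
  obtain ⟨e, he⟩ := iso_iff.1 h
  exact hσ.of_injective (j := e.toLinearMap) e.injective he

theorem IsSmooth.dual [LieGroup I ∞ G] [FiniteDimensional ℂ V] (hρ : IsSmooth I ρ) :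
    IsSmooth I ρ.dual := by
  intro φ ψ
  obtain ⟨v, rfl⟩ := (Module.evalEquiv ℂ V).surjective ψ
  have h1 : (fun x => Module.evalEquiv ℂ V v (ρ.dual x φ)) =
      (fun x => φ (ρ x v)) ∘ fun x => x⁻¹ := by
    funext x
    simp [Representation.dual_apply, Module.Dual.transpose_apply]
  rw [h1]
  exact (hρ v φ).comp (contMDiff_inv I ∞)

theorem IsSmooth.extTensor [FiniteDimensional ℂ V] [FiniteDimensional ℂ V']
    (hρ : IsSmooth I ρ) (hρ' : IsSmooth I' ρ') :
    IsSmooth (I.prod I') (LieRep.extTensor ρ ρ') := by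
  have hmul : ContDiff ℝ ∞ (fun z : ℂ × ℂ => z.1 * z.2) := contDiff_fst.mul contDiff_snd
  intro t φ
  obtain ⟨ψ, rfl⟩ := (TensorProduct.dualDistribEquiv ℂ V V').surjective φ
  induction ψ with
  | zero => simpa using contMDiff_const
  | add a b ha hb =>
    simp only [map_add, LinearMap.add_apply]
    exact ha.add hb
  | tmul φ φ' =>
    induction t with
    | zero => simpa using contMDiff_const
    | add a b ha hb =>
      simp only [map_add]
      exact ha.add hb
    | tmul v v' =>
      have h1 : (fun x : G × G' => TensorProduct.dualDistribEquiv ℂ V V' (φ ⊗ₜ φ')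
          (LieRep.extTensor ρ ρ' x (v ⊗ₜ[ℂ] v'))) =
          fun x => φ (ρ x.1 v) * φ' (ρ' x.2 v') := by
        funext x
        simp [TensorProduct.dualDistribEquiv, TensorProduct.dualDistribEquivOfBasis]
      rw [h1]
      exact hmul.comp_contMDiff
        (((hρ v φ).comp contMDiff_fst).prodMk_space ((hρ' v' φ').comp contMDiff_snd))

theorem IsIrr.dual [LieGroup I ∞ G] [FiniteDimensional ℂ V] (hρ : IsIrr I ρ) :
    IsIrr I ρ.dual :=
  ⟨hρ.smooth.dual, irreducible_dual hρ.irreducible⟩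

theorem IsIrr.extTensor [FiniteDimensional ℂ V] [FiniteDimensional ℂ V']
    (hρ : IsIrr I ρ) (hρ' : IsIrr I' ρ') : IsIrr (I.prod I') (LieRep.extTensor ρ ρ') :=
  ⟨hρ.smooth.extTensor hρ'.smooth, irreducible_extTensor hρ.irreducible hρ'.irreducible⟩

/-- Every irreducible module of a product is an exterior tensor product of irreducible modules. -/
theorem IsIrr.exists_iso_extTensor {U : Type w} [AddCommGroup U] [Module ℂ U]
    [FiniteDimensional ℂ U] {τ : Representation ℂ (G × G') U} (hτ : IsIrr (I.prod I') τ) :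
    ∃ (V V' : Type w) (_ : AddCommGroup V) (_ : Module ℂ V) (_ : FiniteDimensional ℂ V)
      (_ : AddCommGroup V') (_ : Module ℂ V') (_ : FiniteDimensional ℂ V')
      (ρ : Representation ℂ G V) (ρ' : Representation ℂ G' V'),
      IsIrr I ρ ∧ IsIrr I' ρ' ∧ Iso (LieRep.extTensor ρ ρ') τ := by
  have hnt := (isIrreducible_iff.1 hτ.irreducible).1
  let τ₁ : Representation ℂ G U := τ.comp (MonoidHom.inl G G')
  let τ₂ : Representation ℂ G' U := τ.comp (MonoidHom.inr G G')
  have hcomm : ∀ x x' u, τ₁ x (τ₂ x' u) = τ₂ x' (τ₁ x u) := by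
    intro x x' u
    simp only [τ₁, τ₂, MonoidHom.comp_apply, MonoidHom.inl_apply, MonoidHom.inr_apply]
    rw [← Module.End.mul_apply, ← map_mul, ← Module.End.mul_apply, ← map_mul]
    simp
  have hsplit : ∀ x x' u, τ (x, x') u = τ₂ x' (τ₁ x u) := by
    intro x x' u
    simp only [τ₁, τ₂, MonoidHom.comp_apply, MonoidHom.inl_apply, MonoidHom.inr_apply]
    rw [← Module.End.mul_apply, ← map_mul]
    simp
  have hτ₁ : IsSmooth I τ₁ := fun u φ => (hτ.smooth u φ).comp
    (contMDiff_id.prodMk contMDiff_const)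
  have hτ₂ : IsSmooth I' τ₂ := fun u φ => (hτ.smooth u φ).comp
    (contMDiff_const.prodMk contMDiff_id)
  obtain ⟨N, hN⟩ := exists_irreducible_subrepresentation τ₁
  -- The multiplicity space `Hom_G(N, U)`, on which `G'` acts by postcomposition. It lies in the
  -- same universe as `U`, so the hypotheses on the factors apply to its submodules.
  let homs : Submodule ℂ (N.toSubmodule →ₗ[ℂ] U) :=
    { carrier := {f | ∀ x n, f (N.toRepresentation x n) = τ₁ x (f n)}
      add_mem' := fun {f g} hf hg x n => by simp [hf x n, hg x n]
      zero_mem' := fun x n => by simp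
      smul_mem' := fun c f hf x n => by simp [hf x n] }
  let η : Representation ℂ G' homs :=
    { toFun := fun x' =>
        { toFun := fun f => ⟨τ₂ x' ∘ₗ f.1, fun x n => by simp [f.2 x n, hcomm]⟩
          map_add' := fun f g => Subtype.ext (by simp [LinearMap.comp_add])
          map_smul' := fun c f => Subtype.ext (by simp [LinearMap.comp_smul]) }
      map_one' := by ext; simp
      map_mul' := fun x y => by ext; simp }
  have hN1 := (isIrreducible_iff.1 hN).1
  have hnt' : Nontrivial homs := by
    refine ⟨⟨⟨N.toSubmodule.subtype, fun x n => rfl⟩, 0, fun h => ?_⟩⟩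
    obtain ⟨n, hn⟩ := exists_ne (0 : N.toSubmodule)
    exact hn (Subtype.ext (LinearMap.congr_fun (congrArg Subtype.val h) n))
  -- An irreducible piece suffices: `N ⊗ M` is then irreducible, and the nonzero evaluation map to
  -- `U` is an isomorphism by Schur.
  obtain ⟨M, hM⟩ := exists_irreducible_subrepresentation η
  have hM1 := (isIrreducible_iff.1 hM).1
  have hinj : ∀ f : homs, f ≠ 0 → Function.Injective f.1 := fun f hf =>
    injective_of_irreducible hN (fun h => hf (Subtype.ext h)) f.2
  obtain ⟨n, hn⟩ := exists_ne (0 : N.toSubmodule)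
  -- Evaluation at a fixed `n ≠ 0` embeds `M` in `U` as a `G'`-module, which makes `M` smooth.
  let ev : M.toSubmodule →ₗ[ℂ] U := (LinearMap.applyₗ n) ∘ₗ homs.subtype ∘ₗ M.toSubmodule.subtype
  have hev : Function.Injective ev := by
    rw [injective_iff_map_eq_zero]
    intro f hf
    by_contra hf0
    exact hn (hinj f.1 (fun h => hf0 (Subtype.ext h)) (by rw [map_zero]; exact hf))
  refine ⟨N.toSubmodule, M.toSubmodule, inferInstance, inferInstance, inferInstance,
    inferInstance, inferInstance, inferInstance, N.toRepresentation, M.toRepresentation,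
    ⟨hτ₁.of_injective (j := N.toSubmodule.subtype) N.toSubmodule.subtype_injective
      fun x v => rfl, hN⟩, ⟨hτ₂.of_injective hev fun x v => rfl, hM⟩, ?_⟩
  refine iso_of_ne_zero (irreducible_extTensor hN hM) hτ.irreducible
    (f := TensorProduct.lift ((homs.subtype ∘ₗ M.toSubmodule.subtype).flip)) (fun h0 => ?_) ?_
  · obtain ⟨f, hf⟩ := exists_ne (0 : M.toSubmodule)
    exact hn (hinj f.1 (fun h => hf (Subtype.ext h))
      ((LinearMap.congr_fun h0 (n ⊗ₜ f)).trans (map_zero f.1.1).symm))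
  · rintro ⟨x, x'⟩ t
    induction t with
    | zero => simp
    | add a b ha hb => simp only [map_add, ha, hb]
    | tmul m f =>
      rw [extTensor_apply_tmul, hsplit]
      exact congrArg (τ₂ x') (f.1.2 x m)

end Smoothness

/-! ### Invariant Hermitian forms by Haar averaging -/

section Unitary

open MeasureTheory

variable {E : Type*} [NormedAddCommGroup E] [NormedSpace ℝ E]
  {H : Type*} [TopologicalSpace H] {I : ModelWithCorners ℝ E H}
  {G : Type*} [TopologicalSpace G] [ChartedSpace H G] [Group G]
  {V : Type*} [AddCommGroup V] [Module ℂ V] {ρ : Representation ℂ G V}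

/-- Averaging a Hermitian inner product over the compact group gives an invariant one, which is a
conjugate linear equivariant map to the dual. Positivity gives injectivity, and equality of
dimensions gives bijectivity. -/
theorem exists_conj_equiv_dual [LieGroup I ∞ G] [CompactSpace G] [T2Space G]
    [FiniteDimensional ℂ V] (hρ : IsSmooth I ρ) :
    ∃ e : V ≃ₛₗ[starRingEnd ℂ] Module.Dual ℂ V, ∀ x v, e (ρ x v) = ρ.dual x (e v) := by
  have : IsTopologicalGroup G := topologicalGroup_of_lieGroup I ∞
  let _ : MeasurableSpace G := borel G
  have : BorelSpace G := ⟨rfl⟩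
  let μ : Measure G := Measure.haar
  let b := Module.finBasis ℂ V
  -- With `x⁻¹` in the integrand, left invariance of Haar measure yields equivariance.
  let F : V → V → G → ℂ := fun u v x =>
    ∑ i, starRingEnd ℂ (b.repr (ρ x⁻¹ u) i) * b.repr (ρ x⁻¹ v) i
  have hcont : ∀ u v, Continuous (F u v) := by
    intro u v
    have h : ∀ v i, Continuous fun x => b.repr (ρ x⁻¹ v) i := fun v i =>
      ((hρ v (b.coord i)).continuous).comp continuous_inv
    exact continuous_finsetSum _ fun i _ => (Complex.continuous_conj.comp (h u i)).mul (h v i)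
  have hint : ∀ u v, Integrable (F u v) μ := fun u v =>
    (hcont u v).integrable_of_hasCompactSupport (HasCompactSupport.of_compactSpace _)
  have hadd : ∀ u v w x, F u (v + w) x = F u v x + F u w x := fun u v w x => by
    simp [F, mul_add, Finset.sum_add_distrib]
  have hsmul : ∀ u (c : ℂ) v x, F u (c • v) x = c * F u v x := fun u c v x => by
    simp only [F, map_smul, Finsupp.smul_apply, smul_eq_mul, Finset.mul_sum]
    exact Finset.sum_congr rfl fun i _ => by ring
  have hadd' : ∀ u v w x, F (u + v) w x = F u w x + F v w x := fun u v w x => by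
    simp [F, add_mul, Finset.sum_add_distrib]
  have hsmul' : ∀ (c : ℂ) u v x, F (c • u) v x = starRingEnd ℂ c * F u v x := fun c u v x => by
    simp only [F, map_smul, Finsupp.smul_apply, smul_eq_mul, Finset.mul_sum, map_mul]
    exact Finset.sum_congr rfl fun i _ => by ring
  let h : V →ₛₗ[starRingEnd ℂ] Module.Dual ℂ V :=
    { toFun := fun u =>
        { toFun := fun v => ∫ x, F u v x ∂μ
          map_add' := fun v w => by
            simp only [hadd]; exact integral_add (hint u v) (hint u w)
          map_smul' := fun c v => by
            simp only [hsmul]; exact integral_const_mul c _ }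
      map_add' := fun u v => LinearMap.ext fun w => by
        simp only [LinearMap.coe_mk, AddHom.coe_mk, LinearMap.add_apply, hadd']
        exact integral_add (hint u w) (hint v w)
      map_smul' := fun c u => LinearMap.ext fun w => by
        simp only [LinearMap.coe_mk, AddHom.coe_mk, LinearMap.smul_apply, hsmul', smul_eq_mul]
        exact integral_const_mul _ _ }
  have hh : ∀ u v, h u v = ∫ x, F u v x ∂μ := fun _ _ => rfl
  have hequiv : ∀ x v, h (ρ x v) = ρ.dual x (h v) := by
    intro y u
    refine LinearMap.ext fun v => ?_
    rw [Representation.dual_apply, Module.Dual.transpose_apply, LinearMap.comp_apply, hh, hh,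
      ← integral_mul_left_eq_self _ y]
    refine integral_congr_ae (Filter.Eventually.of_forall fun x => ?_)
    have h1 : ∀ w, ρ (y * x)⁻¹ w = ρ x⁻¹ (ρ y⁻¹ w) := fun w => by
      rw [mul_inv_rev, map_mul, Module.End.mul_apply]
    simp only [F, h1]
    simp
  have hinj : Function.Injective h := by
    rw [injective_iff_map_eq_zero]
    intro v hv
    by_contra hv0
    let f : G → ℝ := fun x => ∑ i, Complex.normSq (b.repr (ρ x⁻¹ v) i)
    have hF : ∀ x, F v v x = (f x : ℂ) := fun x => by
      simp [F, f, Complex.normSq_eq_conj_mul_self]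
    have hf : Continuous f := by
      have : f = fun x => (F v v x).re := by funext x; simp [hF]
      rw [this]
      exact Complex.continuous_re.comp (hcont v v)
    have h0 : ∫ x, f x ∂μ = 0 := by
      have h1 : ∫ x, (f x : ℂ) ∂μ = 0 := by
        simp only [← hF]
        exact LinearMap.congr_fun hv v
      rw [integral_complex_ofReal] at h1
      exact_mod_cast h1
    have hpos : 0 < ∫ x, f x ∂μ := by
      refine hf.integral_pos_of_hasCompactSupport_nonneg_nonzero
        (HasCompactSupport.of_compactSpace _)
        (fun x => Finset.sum_nonneg fun i _ => Complex.normSq_nonneg _) (x := 1) fun h1 => hv0 ?_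
      rw [Finset.sum_eq_zero_iff_of_nonneg fun i _ => Complex.normSq_nonneg _] at h1
      refine b.repr.map_eq_zero_iff.1 (Finsupp.ext fun i => ?_)
      simpa using h1 i (Finset.mem_univ i)
    exact hpos.ne' h0
  have hsurj : Function.Surjective h := by
    let hR : V →ₗ[ℝ] Module.Dual ℂ V :=
      { toFun := h
        map_add' := h.map_add
        map_smul' := fun r v => by
          have := h.map_smulₛₗ (r : ℂ) v
          rw [Complex.conj_ofReal] at this
          exact this }
    have hfin : Module.finrank ℝ V = Module.finrank ℝ (Module.Dual ℂ V) := by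
      rw [finrank_real_of_complex, finrank_real_of_complex, Subspace.dual_finrank_eq]
    have : FiniteDimensional ℝ V := FiniteDimensional.complexToReal V
    have : FiniteDimensional ℝ (Module.Dual ℂ V) := FiniteDimensional.complexToReal _
    exact (LinearMap.injective_iff_surjective_of_finrank_eq_finrank hfin (f := hR)).1 hinj
  exact ⟨LinearEquiv.ofBijective h ⟨hinj, hsurj⟩, hequiv⟩

theorem iso_dual_iff [LieGroup I ∞ G] [CompactSpace G] [T2Space G]
    [FiniteDimensional ℂ V] (hρ : IsIrr I ρ) :
    Iso ρ.dual ρ ↔ IsRealType ρ ∨ IsQuaternionicType ρ := by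
  obtain ⟨e, he⟩ := exists_conj_equiv_dual hρ.smooth
  exact iso_dual_iff_of_conj hρ.irreducible e he

end Unitary

/-! ### The operators `D_V` under isomorphism and exterior tensor product -/

section Differential

/-- `Y ⊗ Z ↦ -½ (d Y * d Z + d Z * d Y)`, for a linear map `d` to an algebra. -/
def antiSquare {𝔤 A : Type*} [AddCommGroup 𝔤] [Module ℝ 𝔤] [Ring A] [Algebra ℝ A] (d : 𝔤 →ₗ[ℝ] A) :
    𝔤 ⊗[ℝ] 𝔤 →ₗ[ℝ] A :=
  TensorProduct.lift (-((1 / 2 : ℝ) • ((LinearMap.mul ℝ A).compl₁₂ d d +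
    ((LinearMap.mul ℝ A).compl₁₂ d d).flip)))

/-- This naturality serves both for conjugation by an isomorphism and for the two inclusions `𝔤, 𝔤'
→ 𝔤 ⊕ 𝔤'`. -/
theorem antiSquare_map {𝔤 𝔥 A B : Type*} [AddCommGroup 𝔤] [Module ℝ 𝔤] [AddCommGroup 𝔥]
    [Module ℝ 𝔥] [Ring A] [Algebra ℝ A] [Ring B] [Algebra ℝ B] (d : 𝔤 →ₗ[ℝ] A) (d' : 𝔥 →ₗ[ℝ] B)
    (j : 𝔤 →ₗ[ℝ] 𝔥) (Φ : A →ₐ[ℝ] B) (h : ∀ Y, d' (j Y) = Φ (d Y)) (t : 𝔤 ⊗[ℝ] 𝔤) :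
    antiSquare d' (TensorProduct.map j j t) = Φ (antiSquare d t) := by
  induction t with
  | zero => simp
  | add a b ha hb => simp only [map_add, ha, hb]
  | tmul Y Z => simp [antiSquare, h]

theorem map_mem_symSq {𝔤 𝔥 : Type*} [AddCommGroup 𝔤] [Module ℝ 𝔤] [AddCommGroup 𝔥]
    [Module ℝ 𝔥] (j : 𝔤 →ₗ[ℝ] 𝔥) {t : 𝔤 ⊗[ℝ] 𝔤} (ht : t ∈ symSq 𝔤) :
    TensorProduct.map j j t ∈ symSq 𝔥 := by
  induction ht using Submodule.span_induction with
  | zero => simp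
  | add a b _ _ ha hb => rw [map_add]; exact add_mem ha hb
  | smul c a _ ha => rw [map_smul]; exact Submodule.smul_mem _ _ ha
  | mem t ht =>
    obtain ⟨Y, Z, rfl⟩ := ht
    exact Submodule.subset_span ⟨j Y, j Z, by simp⟩

variable {E : Type*} [NormedAddCommGroup E] [NormedSpace ℝ E]
  {H : Type*} [TopologicalSpace H] {I : ModelWithCorners ℝ E H}
  {G : Type*} [TopologicalSpace G] [ChartedSpace H G] [Group G]
  {E' : Type*} [NormedAddCommGroup E'] [NormedSpace ℝ E']
  {H' : Type*} [TopologicalSpace H'] {I' : ModelWithCorners ℝ E' H'}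
  {G' : Type*} [TopologicalSpace G'] [ChartedSpace H' G'] [Group G']
  {V : Type*} [AddCommGroup V] [Module ℂ V] [FiniteDimensional ℂ V]
  {V' : Type*} [AddCommGroup V'] [Module ℂ V'] [FiniteDimensional ℂ V']
  {W : Type*} [AddCommGroup W] [Module ℂ W] [FiniteDimensional ℂ W]
  {ρ : Representation ℂ G V} {σ : Representation ℂ G W} {ρ' : Representation ℂ G' V'}

theorem symOp_eq_antiSquare (s : symSq (GroupLieAlgebra I G)) :
    symOp I ρ s = antiSquare (differential I ρ) s.1 := by
  obtain ⟨t, ht⟩ := s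
  change TensorProduct.lift _ t = TensorProduct.lift _ t
  congr 1

theorem differential_conj (hρ : IsSmooth I ρ) (hσ : IsSmooth I σ) (e : V ≃ₗ[ℂ] W)
    (he : ∀ x v, e (ρ x v) = σ x (e v)) (Y : GroupLieAlgebra I G) :
    differential I σ Y = e.conjAlgEquiv ℂ (differential I ρ Y) := by
  refine LinearMap.ext fun w => ?_
  obtain ⟨v, rfl⟩ := e.surjective w
  rw [← sub_eq_zero, ← Module.forall_dual_apply_eq_zero_iff ℂ]
  intro φ
  rw [map_sub, sub_eq_zero, apply_differential I hσ]
  have h1 := apply_differential I hρ Y v (φ ∘ₗ e.toLinearMap)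
  have h2 : (fun x : G => (φ ∘ₗ e.toLinearMap) (ρ x v)) = fun x => φ (σ x (e v)) := by
    funext x; simp [he]
  rw [h2] at h1
  refine Eq.trans h1.symm ?_
  simp

theorem symOp_conj (hρ : IsSmooth I ρ) (hσ : IsSmooth I σ) (e : V ≃ₗ[ℂ] W)
    (he : ∀ x v, e (ρ x v) = σ x (e v)) (s : symSq (GroupLieAlgebra I G)) :
    symOp I σ s = e.conjAlgEquiv ℂ (symOp I ρ s) := by
  rw [symOp_eq_antiSquare, symOp_eq_antiSquare]
  have := antiSquare_map (differential I ρ) (differential I σ) LinearMap.id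
    ((e.conjAlgEquiv ℂ).toAlgHom.restrictScalars ℝ) (differential_conj hρ hσ e he) s.1
  rw [TensorProduct.map_id] at this
  exact this

theorem charP_eq_of_iso (hρ : IsSmooth I ρ) (h : Iso ρ σ) : charP I ρ = charP I σ := by
  obtain ⟨e, he⟩ := iso_iff.1 h
  have hσ : IsSmooth I σ := h.symm.isSmooth hρ
  funext s
  rw [charP, charP, symOp_conj hρ hσ e he, e.finrank_eq]
  congr 1
  exact (LinearEquiv.charpoly_conj e _).symm

variable (I I' G G') in
/-- The inclusion of Lie algebras `𝔤 → 𝔤 ⊕ 𝔤'`. -/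
def inlLie : GroupLieAlgebra I G →ₗ[ℝ] GroupLieAlgebra (I.prod I') (G × G') :=
  (mfderiv I (I.prod I') (fun x : G => (x, (1 : G'))) 1).toLinearMap

variable (I I' G G') in
/-- The inclusion of Lie algebras `𝔤' → 𝔤 ⊕ 𝔤'`. -/
def inrLie : GroupLieAlgebra I' G' →ₗ[ℝ] GroupLieAlgebra (I.prod I') (G × G') :=
  (mfderiv I' (I.prod I') (fun x : G' => ((1 : G), x)) 1).toLinearMap

/-- The chain rule along `x ↦ (x, 1)`, tested on matrix coefficients. -/
theorem differential_extTensor_inlLie (hρ : IsSmooth I ρ) (hρ' : IsSmooth I' ρ')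
    (Y : GroupLieAlgebra I G) :
    differential (I.prod I') (extTensor ρ ρ') (inlLie I G I' G' Y) =
      TensorProduct.map (differential I ρ Y) LinearMap.id := by
  refine TensorProduct.ext' fun v v' => ?_
  rw [← sub_eq_zero, ← Module.forall_dual_apply_eq_zero_iff ℂ]
  intro φ
  rw [map_sub, sub_eq_zero, apply_differential _ (hρ.extTensor hρ')]
  have h1 := apply_differential I hρ Y v (φ ∘ₗ (TensorProduct.mk ℂ V V').flip v')
  have h2 : (fun x : G => (φ ∘ₗ (TensorProduct.mk ℂ V V').flip v') (ρ x v)) =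
      (fun x : G × G' => φ (extTensor ρ ρ' x (v ⊗ₜ v'))) ∘ fun x => (x, 1) := by
    funext x; simp
  rw [h2] at h1
  have hg : MDifferentiableAt I (I.prod I') (fun x : G => (x, (1 : G'))) 1 :=
    mdifferentiableAt_id.prodMk mdifferentiableAt_const
  have h3 := mfderiv_comp (1 : G)
    (((hρ.extTensor hρ') (v ⊗ₜ v') φ).mdifferentiable (by simp) (1, 1)) hg
  exact (h1.trans (congrArg (fun L => L Y) h3)).symm

theorem differential_extTensor_inrLie (hρ : IsSmooth I ρ) (hρ' : IsSmooth I' ρ')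
    (Y : GroupLieAlgebra I' G') :
    differential (I.prod I') (extTensor ρ ρ') (inrLie I G I' G' Y) =
      TensorProduct.map LinearMap.id (differential I' ρ' Y) := by
  refine TensorProduct.ext' fun v v' => ?_
  rw [← sub_eq_zero, ← Module.forall_dual_apply_eq_zero_iff ℂ]
  intro φ
  rw [map_sub, sub_eq_zero, apply_differential _ (hρ.extTensor hρ')]
  have h1 := apply_differential I' hρ' Y v' (φ ∘ₗ TensorProduct.mk ℂ V V' v)
  have h2 : (fun x : G' => (φ ∘ₗ TensorProduct.mk ℂ V V' v) (ρ' x v')) =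
      (fun x : G × G' => φ (extTensor ρ ρ' x (v ⊗ₜ v'))) ∘ fun x => (1, x) := by
    funext x; simp
  rw [h2] at h1
  have hg : MDifferentiableAt I' (I.prod I') (fun x : G' => ((1 : G), x)) 1 :=
    mdifferentiableAt_const.prodMk mdifferentiableAt_id
  have h3 := mfderiv_comp (1 : G')
    (((hρ.extTensor hρ') (v ⊗ₜ v') φ).mdifferentiable (by simp) (1, 1)) hg
  exact (h1.trans (congrArg (fun L => L Y) h3)).symm

/-- `s + s'` as an element of `Sym²(𝔤 ⊕ 𝔤')`. -/
def symSum (s : symSq (GroupLieAlgebra I G)) (s' : symSq (GroupLieAlgebra I' G')) :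
    symSq (GroupLieAlgebra (I.prod I') (G × G')) :=
  ⟨TensorProduct.map (inlLie I G I' G') (inlLie I G I' G') s.1 +
    TensorProduct.map (inrLie I G I' G') (inrLie I G I' G') s'.1,
    add_mem (map_mem_symSq _ s.2) (map_mem_symSq _ s'.2)⟩

/-- The maps `A ↦ A ⊗ 1` and `B ↦ 1 ⊗ B` are algebra homomorphisms, so naturality applies to each
summand. No mixed terms `Y · Y'` occur in `symSum`. -/
theorem symOp_extTensor (hρ : IsSmooth I ρ) (hρ' : IsSmooth I' ρ')
    (s : symSq (GroupLieAlgebra I G)) (s' : symSq (GroupLieAlgebra I' G')) :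
    symOp (I.prod I') (extTensor ρ ρ') (symSum s s') =
      TensorProduct.map (symOp I ρ s) LinearMap.id +
        TensorProduct.map LinearMap.id (symOp I' ρ' s') := by
  let Φ : Module.End ℂ V →ₐ[ℝ] Module.End ℂ (V ⊗[ℂ] V') :=
    (Module.End.rTensorAlgHom ℂ V V').restrictScalars ℝ
  let Φ' : Module.End ℂ V' →ₐ[ℝ] Module.End ℂ (V ⊗[ℂ] V') :=
    (Module.End.lTensorAlgHom ℂ V' V).restrictScalars ℝ
  have h := antiSquare_map (differential I ρ) (differential (I.prod I') (extTensor ρ ρ'))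
    (inlLie I G I' G') Φ (differential_extTensor_inlLie hρ hρ') s.1
  have h' := antiSquare_map (differential I' ρ') (differential (I.prod I') (extTensor ρ ρ'))
    (inrLie I G I' G') Φ' (differential_extTensor_inrLie hρ hρ') s'.1
  rw [symOp_eq_antiSquare, symOp_eq_antiSquare, symOp_eq_antiSquare, symSum, map_add]
  exact congrArg₂ (· + ·) h h'

open Polynomial

theorem charP_ne_zero (s : symSq (GroupLieAlgebra I G)) : charP I ρ s ≠ 0 :=
  mul_ne_zero (pow_ne_zero _ (by simp)) (LinearMap.charpoly_monic _).ne_zero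

theorem isRoot_iterate_derivative_charP (s : symSq (GroupLieAlgebra I G)) (k : ℕ) (z : ℂ) :
    (derivative^[k] (charP I ρ s)).IsRoot z ↔ (derivative^[k] (symOp I ρ s).charpoly).IsRoot z := by
  have h : charP I ρ s = C ((-1) ^ Module.finrank ℂ V) * (symOp I ρ s).charpoly := by
    simp [charP]
  rw [h, iterate_derivative_C_mul]
  simp [IsRoot]

/-- A function is nonzero when some value is; the sign in `charP` does not affect roots. -/
theorem aPoly_ne_zero_iff : aPoly I ρ σ ≠ 0 ↔ ∃ s, ∀ z,
    (symOp I ρ s).charpoly.IsRoot z → ¬ (symOp I σ s).charpoly.IsRoot z := by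
  rw [Function.ne_iff]
  refine exists_congr fun s => ?_
  rw [Pi.zero_apply, aPoly, resultant_ne_zero_iff_forall_root (charP_ne_zero s)]
  exact forall_congr' fun z => imp_congr (isRoot_iterate_derivative_charP s 0 z)
    (not_congr (isRoot_iterate_derivative_charP s 0 z))

theorem bPoly_ne_zero_iff : bPoly I ρ ≠ 0 ↔ ∃ s, ∀ z,
    (symOp I ρ s).charpoly.IsRoot z → ¬ (derivative^[1] (symOp I ρ s).charpoly).IsRoot z := by
  rw [Function.ne_iff]
  refine exists_congr fun s => ?_
  rw [Pi.zero_apply, bPoly, resultant_ne_zero_iff_forall_root (charP_ne_zero s)]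
  exact forall_congr' fun z => imp_congr (isRoot_iterate_derivative_charP s 0 z)
    (not_congr (isRoot_iterate_derivative_charP s 1 z))

theorem cPoly_ne_zero_iff : cPoly I ρ ≠ 0 ↔ ∃ s, ∀ z,
    (symOp I ρ s).charpoly.IsRoot z → ¬ (derivative^[2] (symOp I ρ s).charpoly).IsRoot z := by
  rw [Function.ne_iff]
  refine exists_congr fun s => ?_
  rw [Pi.zero_apply, cPoly, resultant_ne_zero_iff_forall_root (charP_ne_zero s)]
  exact forall_congr' fun z => imp_congr (isRoot_iterate_derivative_charP s 0 z)
    (not_congr (isRoot_iterate_derivative_charP s 2 z))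

end Differential

/-! ### Inheritance of nonvanishing of a, b and c by exterior tensor products -/

section ExteriorTensorPolynomials

open Polynomial

variable {E : Type*} [NormedAddCommGroup E] [NormedSpace ℝ E]
  {H : Type*} [TopologicalSpace H] {I : ModelWithCorners ℝ E H}
  {G : Type*} [TopologicalSpace G] [ChartedSpace H G] [Group G]
  {E' : Type*} [NormedAddCommGroup E'] [NormedSpace ℝ E']
  {H' : Type*} [TopologicalSpace H'] {I' : ModelWithCorners ℝ E' H'}
  {G' : Type*} [TopologicalSpace G'] [ChartedSpace H' G'] [Group G']
  {V : Type*} [AddCommGroup V] [Module ℂ V] [FiniteDimensional ℂ V]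
  {V' : Type*} [AddCommGroup V'] [Module ℂ V'] [FiniteDimensional ℂ V']
  {W : Type*} [AddCommGroup W] [Module ℂ W] [FiniteDimensional ℂ W]
  {W' : Type*} [AddCommGroup W'] [Module ℂ W'] [FiniteDimensional ℂ W']
  {ρ : Representation ℂ G V} {σ : Representation ℂ G W}
  {ρ' : Representation ℂ G' V'} {σ' : Representation ℂ G' W'}

theorem aPoly_eq_of_iso {U : Type*} [AddCommGroup U] [Module ℂ U] [FiniteDimensional ℂ U]
    {U' : Type*} [AddCommGroup U'] [Module ℂ U'] [FiniteDimensional ℂ U']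
    {τ : Representation ℂ G U} {τ' : Representation ℂ G U'} (hρ : IsSmooth I ρ)
    (hσ : IsSmooth I σ) (h : Iso ρ τ) (h' : Iso σ τ') : aPoly I ρ σ = aPoly I τ τ' := by
  funext s
  rw [aPoly, aPoly, charP_eq_of_iso hρ h, charP_eq_of_iso hσ h']

theorem bPoly_eq_of_iso (hρ : IsSmooth I ρ) (h : Iso ρ σ) : bPoly I ρ = bPoly I σ := by
  funext s
  rw [bPoly, bPoly, charP_eq_of_iso hρ h]

theorem cPoly_eq_of_iso (hρ : IsSmooth I ρ) (h : Iso ρ σ) : cPoly I ρ = cPoly I σ := by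
  funext s
  rw [cPoly, cPoly, charP_eq_of_iso hρ h]

theorem symOp_smul_complex (t : ℝ) (s : symSq (GroupLieAlgebra I G)) :
    symOp I ρ (t • s) = (t : ℂ) • symOp I ρ s := by
  rw [map_smul]
  rfl

theorem charpoly_symOp_extTensor (hρ : IsSmooth I ρ) (hρ' : IsSmooth I' ρ')
    (s : symSq (GroupLieAlgebra I G)) (s' : symSq (GroupLieAlgebra I' G')) :
    (symOp (I.prod I') (extTensor ρ ρ') (symSum s s')).charpoly =
      sumPoly (symOp I ρ s).charpoly.roots (symOp I' ρ' s').charpoly.roots 1 := by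
  rw [symOp_extTensor hρ hρ', charpoly_tensorSum]
  simp [sumPoly]

theorem charpoly_symOp_extTensor_smul_right (hρ : IsSmooth I ρ) (hρ' : IsSmooth I' ρ')
    (s : symSq (GroupLieAlgebra I G)) (s' : symSq (GroupLieAlgebra I' G')) {t : ℝ} (ht : t ≠ 0) :
    (symOp (I.prod I') (extTensor ρ ρ') (symSum s (t • s'))).charpoly =
      sumPoly (symOp I ρ s).charpoly.roots (symOp I' ρ' s').charpoly.roots t := by
  rw [charpoly_symOp_extTensor hρ hρ', symOp_smul_complex,
    roots_charpoly_smul _ (Complex.ofReal_ne_zero.2 ht)]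
  simp [sumPoly]

theorem charpoly_symOp_extTensor_smul_left (hρ : IsSmooth I ρ) (hρ' : IsSmooth I' ρ')
    (s : symSq (GroupLieAlgebra I G)) (s' : symSq (GroupLieAlgebra I' G')) {t : ℝ} (ht : t ≠ 0) :
    (symOp (I.prod I') (extTensor ρ ρ') (symSum (t • s) s')).charpoly =
      sumPoly (symOp I' ρ' s').charpoly.roots (symOp I ρ s).charpoly.roots t := by
  rw [charpoly_symOp_extTensor hρ hρ', symOp_smul_complex,
    roots_charpoly_smul _ (Complex.ofReal_ne_zero.2 ht)]
  simp only [sumPoly, Multiset.map_map, Function.comp_def]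
  rw [Multiset.prod_map_prod_map]
  simp [add_comm]

theorem isRoot_charpoly_zero {z : ℂ} (h : (0 : Module.End ℂ V).charpoly.IsRoot z) : z = 0 := by
  rw [LinearMap.charpoly_zero, IsRoot, eval_pow, eval_X] at h
  exact eq_zero_of_pow_eq_zero h

/-- With `s' = 0` the second factor contributes only the eigenvalue `0`, so the roots are those of
the first factors, up to multiplicity. -/
theorem aPoly_extTensor_ne_zero_of_left (hρ : IsSmooth I ρ) (hσ : IsSmooth I σ)
    (hρ' : IsSmooth I' ρ') (hσ' : IsSmooth I' σ') (h : aPoly I ρ σ ≠ 0) :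
    aPoly (I.prod I') (extTensor ρ ρ') (extTensor σ σ') ≠ 0 := by
  obtain ⟨s, hs⟩ := aPoly_ne_zero_iff.1 h
  refine aPoly_ne_zero_iff.2 ⟨symSum s 0, fun z h1 h2 => ?_⟩
  rw [charpoly_symOp_extTensor hρ hρ', isRoot_sumPoly] at h1
  rw [charpoly_symOp_extTensor hσ hσ', isRoot_sumPoly] at h2
  obtain ⟨a, ha, b, hb, rfl⟩ := h1
  obtain ⟨c, hc, d, hd, hz⟩ := h2
  rw [map_zero] at hb hd
  rw [isRoot_charpoly_zero (isRoot_of_mem_roots hb),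
    isRoot_charpoly_zero (isRoot_of_mem_roots hd), mul_zero, add_zero, add_zero] at hz
  exact hs a (isRoot_of_mem_roots ha) (hz ▸ isRoot_of_mem_roots hc)

theorem aPoly_extTensor_ne_zero_of_right (hρ : IsSmooth I ρ) (hσ : IsSmooth I σ)
    (hρ' : IsSmooth I' ρ') (hσ' : IsSmooth I' σ') (h : aPoly I' ρ' σ' ≠ 0) :
    aPoly (I.prod I') (extTensor ρ ρ') (extTensor σ σ') ≠ 0 := by
  obtain ⟨s, hs⟩ := aPoly_ne_zero_iff.1 h
  refine aPoly_ne_zero_iff.2 ⟨symSum 0 s, fun z h1 h2 => ?_⟩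
  rw [charpoly_symOp_extTensor hρ hρ', isRoot_sumPoly] at h1
  rw [charpoly_symOp_extTensor hσ hσ', isRoot_sumPoly] at h2
  obtain ⟨a, ha, b, hb, rfl⟩ := h1
  obtain ⟨c, hc, d, hd, hz⟩ := h2
  rw [map_zero] at ha hc
  rw [isRoot_charpoly_zero (isRoot_of_mem_roots ha),
    isRoot_charpoly_zero (isRoot_of_mem_roots hc), zero_add, zero_add, one_mul, one_mul] at hz
  exact hs b (isRoot_of_mem_roots hb) (hz ▸ isRoot_of_mem_roots hd)

theorem iterate_derivative_prod_roots_charpoly {A : Module.End ℂ V} {k : ℕ}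
    (h : ∀ z, A.charpoly.IsRoot z → ¬ (derivative^[k] A.charpoly).IsRoot z) :
    ∀ b ∈ A.charpoly.roots,
      (derivative^[k] (A.charpoly.roots.map fun b => X - C b).prod).eval b ≠ 0 := by
  intro b hb
  rw [← (IsAlgClosed.splits A.charpoly).eq_prod_roots_of_monic A.charpoly_monic]
  exact h b (isRoot_of_mem_roots hb)

theorem bPoly_extTensor_ne_zero (hρ : IsSmooth I ρ) (hρ' : IsSmooth I' ρ')
    (h : bPoly I ρ ≠ 0) (h' : bPoly I' ρ' ≠ 0) : bPoly (I.prod I') (extTensor ρ ρ') ≠ 0 := by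
  obtain ⟨s, hs⟩ := bPoly_ne_zero_iff.1 h
  obtain ⟨s', hs'⟩ := bPoly_ne_zero_iff.1 h'
  obtain ⟨t, ht, h1⟩ := exists_real_iterate_derivative_sumPoly_ne_zero
    (nodup_roots_of_derivative hs) (iterate_derivative_prod_roots_charpoly hs')
  refine bPoly_ne_zero_iff.2 ⟨symSum s (t • s'), ?_⟩
  rwa [charpoly_symOp_extTensor_smul_right hρ hρ' s s' ht]

/-- Bounding multiplicities by two would not suffice, since the second derivative must also be
nonzero at simple roots. Hence the cluster argument with k = 2. -/
theorem cPoly_extTensor_ne_zero_of_right (hρ : IsSmooth I ρ) (hρ' : IsSmooth I' ρ')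
    (h : bPoly I ρ ≠ 0) (h' : cPoly I' ρ' ≠ 0) : cPoly (I.prod I') (extTensor ρ ρ') ≠ 0 := by
  obtain ⟨s, hs⟩ := bPoly_ne_zero_iff.1 h
  obtain ⟨s', hs'⟩ := cPoly_ne_zero_iff.1 h'
  obtain ⟨t, ht, h1⟩ := exists_real_iterate_derivative_sumPoly_ne_zero
    (nodup_roots_of_derivative hs) (iterate_derivative_prod_roots_charpoly hs')
  refine cPoly_ne_zero_iff.2 ⟨symSum s (t • s'), ?_⟩
  rwa [charpoly_symOp_extTensor_smul_right hρ hρ' s s' ht]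

theorem cPoly_extTensor_ne_zero_of_left (hρ : IsSmooth I ρ) (hρ' : IsSmooth I' ρ')
    (h : cPoly I ρ ≠ 0) (h' : bPoly I' ρ' ≠ 0) : cPoly (I.prod I') (extTensor ρ ρ') ≠ 0 := by
  obtain ⟨s, hs⟩ := cPoly_ne_zero_iff.1 h
  obtain ⟨s', hs'⟩ := bPoly_ne_zero_iff.1 h'
  obtain ⟨t, ht, h1⟩ := exists_real_iterate_derivative_sumPoly_ne_zero
    (nodup_roots_of_derivative hs') (iterate_derivative_prod_roots_charpoly hs)
  refine cPoly_ne_zero_iff.2 ⟨symSum (t • s) s', ?_⟩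
  rwa [charpoly_symOp_extTensor_smul_left hρ hρ' s s' ht]

end ExteriorTensorPolynomials

/-! ### Types of exterior tensor products -/

section TensorTypes

variable {G G' : Type*} [Group G] [Group G']
  {V : Type*} [AddCommGroup V] [Module ℂ V]
  {V' : Type*} [AddCommGroup V'] [Module ℂ V']
  {W : Type*} [AddCommGroup W] [Module ℂ W]
  {W' : Type*} [AddCommGroup W'] [Module ℂ W']
  {ρ : Representation ℂ G V} {ρ' : Representation ℂ G' V'}
  {σ : Representation ℂ G W} {σ' : Representation ℂ G' W'}

theorem iso_extTensor_swap (h : Iso (extTensor ρ ρ') (extTensor σ σ')) :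
    Iso (extTensor ρ' ρ) (extTensor σ' σ) := by
  obtain ⟨e, he⟩ := iso_iff.1 h
  refine iso_iff.2 ⟨(TensorProduct.comm ℂ V' V).trans (e.trans (TensorProduct.comm ℂ W W')),
    fun x t => ?_⟩
  have h1 : TensorProduct.comm ℂ V' V (extTensor ρ' ρ x t) =
      extTensor ρ ρ' x.swap (TensorProduct.comm ℂ V' V t) := by
    induction t with
    | zero => simp
    | add a b ha hb => simp only [map_add, ha, hb]
    | tmul v v' => simp
  have h2 : ∀ u, TensorProduct.comm ℂ W W' (extTensor σ σ' x.swap u) =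
      extTensor σ' σ x (TensorProduct.comm ℂ W W' u) := by
    intro u
    induction u with
    | zero => simp
    | add a b ha hb => simp only [map_add, ha, hb]
    | tmul v v' => simp
  simp only [LinearEquiv.trans_apply, h1, he, h2]

theorem iso_right_of_iso_extTensor [FiniteDimensional ℂ W] [FiniteDimensional ℂ W']
    (hρ : ρ.IsIrreducible) (hρ' : ρ'.IsIrreducible)
    (hσ' : σ'.IsIrreducible) (h : Iso (extTensor ρ ρ') (extTensor σ σ')) : Iso ρ' σ' :=
  iso_left_of_iso_extTensor hρ' hρ hσ' (iso_extTensor_swap h)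

theorem IsRealType.extTensor (h : IsRealType ρ) (h' : IsRealType ρ') :
    IsRealType (extTensor ρ ρ') := by
  rw [isRealType_iff] at *
  simpa using h.extTensor h'

theorem IsQuaternionicType.extTensor (h : IsQuaternionicType ρ) (h' : IsQuaternionicType ρ') :
    IsRealType (extTensor ρ ρ') := by
  rw [isQuaternionicType_iff] at *
  rw [isRealType_iff]
  simpa using h.extTensor h'

theorem IsRealType.extTensor_quaternionic (h : IsRealType ρ) (h' : IsQuaternionicType ρ') :
    IsQuaternionicType (LieRep.extTensor ρ ρ') := by
  rw [isQuaternionicType_iff] at *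
  rw [isRealType_iff] at h
  simpa using h.extTensor h'

theorem IsQuaternionicType.extTensor_real (h : IsQuaternionicType ρ) (h' : IsRealType ρ') :
    IsQuaternionicType (LieRep.extTensor ρ ρ') := by
  rw [isQuaternionicType_iff] at *
  rw [isRealType_iff] at h'
  simpa using h.extTensor h'

end TensorTypes

/-! ### Complex type as failure of self-duality -/

section ComplexTypes

variable {E : Type*} [NormedAddCommGroup E] [NormedSpace ℝ E]
  {H : Type*} [TopologicalSpace H] {I : ModelWithCorners ℝ E H}
  {G : Type*} [TopologicalSpace G] [ChartedSpace H G] [Group G] [LieGroup I ∞ G]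
  {E' : Type*} [NormedAddCommGroup E'] [NormedSpace ℝ E']
  {H' : Type*} [TopologicalSpace H'] {I' : ModelWithCorners ℝ E' H'}
  {G' : Type*} [TopologicalSpace G'] [ChartedSpace H' G'] [Group G'] [LieGroup I' ∞ G']
  {V : Type*} [AddCommGroup V] [Module ℂ V] [FiniteDimensional ℂ V]
  {V' : Type*} [AddCommGroup V'] [Module ℂ V'] [FiniteDimensional ℂ V']
  {ρ : Representation ℂ G V} {ρ' : Representation ℂ G' V'}

theorem isComplexType_iff [CompactSpace G] [T2Space G] (hρ : IsIrr I ρ) : IsComplexType ρ ↔ ¬ Iso ρ.dual ρ := by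
  rw [iso_dual_iff hρ, IsComplexType, not_or]

/-- The dual of the product is the product of the duals, and the factors of an irreducible product
are unique. -/
theorem iso_dual_of_iso_dual_extTensor (hρ : IsIrr I ρ) (hρ' : IsIrr I' ρ')
    (h : Iso (extTensor ρ ρ').dual (extTensor ρ ρ')) : Iso ρ.dual ρ ∧ Iso ρ'.dual ρ' := by
  have h1 := iso_dual_extTensor.trans h
  exact ⟨iso_left_of_iso_extTensor hρ.dual.irreducible hρ'.dual.irreducible hρ.irreducible h1,
    iso_right_of_iso_extTensor hρ.dual.irreducible hρ'.dual.irreducible hρ'.irreducible h1⟩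

theorem isComplexType_extTensor [CompactSpace G] [T2Space G] [CompactSpace G'] [T2Space G']
    (hρ : IsIrr I ρ) (hρ' : IsIrr I' ρ')
    (h : IsComplexType ρ ∨ IsComplexType ρ') : IsComplexType (extTensor ρ ρ') := by
  rw [isComplexType_iff (hρ.extTensor hρ')]
  intro h1
  obtain ⟨h2, h3⟩ := iso_dual_of_iso_dual_extTensor hρ hρ' h1
  rcases h with h | h
  · exact (isComplexType_iff hρ).1 h h2
  · exact (isComplexType_iff hρ').1 h h3

end ComplexTypes

end LieRep

end

/-! ### Assembly by types -/

theorem mainTheorem7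
    {E : Type*} [NormedAddCommGroup E] [NormedSpace ℝ E] [FiniteDimensional ℝ E]
    {H : Type*} [TopologicalSpace H] (I : ModelWithCorners ℝ E H) [I.Boundaryless]
    (G : Type*) [TopologicalSpace G] [ChartedSpace H G] [Group G] [LieGroup I ∞ G]
    [CompactSpace G] [T2Space G]
    {E' : Type*} [NormedAddCommGroup E'] [NormedSpace ℝ E'] [FiniteDimensional ℝ E']
    {H' : Type*} [TopologicalSpace H'] (I' : ModelWithCorners ℝ E' H') [I'.Boundaryless]
    (G' : Type*) [TopologicalSpace G'] [ChartedSpace H' G'] [Group G'] [LieGroup I' ∞ G']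
    [CompactSpace G'] [T2Space G']
    (hA : LieRep.CondA.{w} I G) (hB : LieRep.CondB.{w} I G) (hC : LieRep.CondC.{w} I G)
    (hA' : LieRep.CondA.{w} I' G') (hB' : LieRep.CondB.{w} I' G')
    (hC' : LieRep.CondC.{w} I' G') :
    LieRep.CondC.{w} (I.prod I') (G × G') ∧
    (LieRep.CondA.{w} (I.prod I') (G × G') ↔
      ∀ (V V' : Type w) [AddCommGroup V] [Module ℂ V] [FiniteDimensional ℂ V]
        [AddCommGroup V'] [Module ℂ V'] [FiniteDimensional ℂ V']
        (ρ : Representation ℂ G V) (ρ' : Representation ℂ G' V'),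
        LieRep.IsIrr I ρ → LieRep.IsIrr I' ρ' →
        LieRep.IsComplexType ρ → LieRep.IsComplexType ρ' →
        LieRep.aPoly (I.prod I') (LieRep.extTensor ρ ρ') (LieRep.extTensor ρ.dual ρ') ≠ 0 ∧
        LieRep.aPoly (I.prod I') (LieRep.extTensor ρ ρ') (LieRep.extTensor ρ ρ'.dual) ≠ 0) ∧
    (LieRep.CondB.{w} (I.prod I') (G × G') ↔
      ∀ (V V' : Type w) [AddCommGroup V] [Module ℂ V] [FiniteDimensional ℂ V]
        [AddCommGroup V'] [Module ℂ V'] [FiniteDimensional ℂ V']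
        (ρ : Representation ℂ G V) (ρ' : Representation ℂ G' V'),
        LieRep.IsIrr I ρ → LieRep.IsIrr I' ρ' →
        (LieRep.IsQuaternionicType ρ ∧ LieRep.IsQuaternionicType ρ') ∨
          (LieRep.IsQuaternionicType ρ ∧ LieRep.IsComplexType ρ') ∨
          (LieRep.IsComplexType ρ ∧ LieRep.IsQuaternionicType ρ') →
        LieRep.bPoly (I.prod I') (LieRep.extTensor ρ ρ') ≠ 0) := by
  open LieRep in
  refine ⟨?_, ⟨?_, ?_⟩, ⟨?_, ?_⟩⟩
  · intro U _ _ _ τ hτ hq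
    obtain ⟨V, V', _, _, _, _, _, _, ρ, ρ', hρ, hρ', hiso⟩ := hτ.exists_iso_extTensor
    have hext := hρ.extTensor hρ'
    rw [← cPoly_eq_of_iso hext.smooth hiso]
    have hq' : IsQuaternionicType (extTensor ρ ρ') :=
      isQuaternionicType_iff.2 ((isQuaternionicType_iff.1 hq).iso hiso.symm)
    have hnr : ¬ IsRealType (extTensor ρ ρ') := fun h =>
      not_real_and_quaternionic hext.irreducible ⟨h, hq'⟩
    obtain ⟨h1, h2⟩ := iso_dual_of_iso_dual_extTensor hρ hρ' ((iso_dual_iff hext).2 (Or.inr hq'))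
    -- Both factors are self-dual; equal types would make the product real, so one factor is real
    -- and the other quaternionic.
    rcases (iso_dual_iff hρ).1 h1 with h1 | h1 <;> rcases (iso_dual_iff hρ').1 h2 with h2 | h2
    · exact absurd (h1.extTensor h2) hnr
    · exact cPoly_extTensor_ne_zero_of_right hρ.smooth hρ'.smooth (hB V ρ hρ (Or.inl h1))
        (hC' V' ρ' hρ' h2)
    · exact cPoly_extTensor_ne_zero_of_left hρ.smooth hρ'.smooth (hC V ρ hρ h1)
        (hB' V' ρ' hρ' (Or.inl h2))
    · exact absurd (h1.extTensor h2) hnr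
  · intro h V V' _ _ _ _ _ _ ρ ρ' hρ hρ' hc hc'
    have hn := (isComplexType_iff hρ).1 hc
    have hn' := (isComplexType_iff hρ').1 hc'
    refine ⟨h _ _ _ _ (hρ.extTensor hρ') (hρ.dual.extTensor hρ') (fun h1 => hn ?_)
      (fun h1 => hn' ?_), h _ _ _ _ (hρ.extTensor hρ') (hρ.extTensor hρ'.dual) (fun h1 => hn' ?_)
      (fun h1 => hn ?_)⟩
    · exact (iso_left_of_iso_extTensor hρ.irreducible hρ'.irreducible hρ.dual.irreducible h1).symm
    · exact iso_right_of_iso_extTensor hρ.dual.irreducible hρ'.dual.irreducible hρ'.irreducible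
        (iso_dual_extTensor.trans h1)
    · exact (iso_right_of_iso_extTensor hρ.irreducible hρ'.irreducible
        hρ'.dual.irreducible h1).symm
    · exact iso_left_of_iso_extTensor hρ.dual.irreducible hρ'.dual.irreducible hρ.irreducible
        (iso_dual_extTensor.trans h1)
  · intro h U₁ U₂ _ _ _ _ _ _ τ₁ τ₂ hτ₁ hτ₂ hn hnd
    obtain ⟨V, V', _, _, _, _, _, _, ρ, ρ', hρ, hρ', hiso₁⟩ := hτ₁.exists_iso_extTensor
    obtain ⟨W, W', _, _, _, _, _, _, σ, σ', hσ, hσ', hiso₂⟩ := hτ₂.exists_iso_extTensor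
    have hext := hρ.extTensor hρ'
    rw [← aPoly_eq_of_iso hext.smooth (hσ.extTensor hσ').smooth hiso₁ hiso₂]
    have hn₁ : ¬ (Iso ρ σ ∧ Iso ρ' σ') := fun h1 =>
      hn ((hiso₁.symm.trans (h1.1.extTensor h1.2)).trans hiso₂)
    have hn₂ : ¬ (Iso ρ.dual σ ∧ Iso ρ'.dual σ') := fun h1 =>
      hnd (((hiso₁.symm.dual.trans iso_dual_extTensor.symm).trans
        (h1.1.extTensor h1.2)).trans hiso₂)
    -- Unless `W` is `V` or `V*`, and likewise for the primed factors, condition (a) of a single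
    -- factor suffices.
    by_cases h1 : Iso ρ σ ∨ Iso ρ.dual σ
    swap
    · rw [not_or] at h1
      exact aPoly_extTensor_ne_zero_of_left hρ.smooth hσ.smooth hρ'.smooth hσ'.smooth
        (hA _ _ _ _ hρ hσ h1.1 h1.2)
    by_cases h2 : Iso ρ' σ' ∨ Iso ρ'.dual σ'
    swap
    · rw [not_or] at h2
      exact aPoly_extTensor_ne_zero_of_right hρ.smooth hσ.smooth hρ'.smooth hσ'.smooth
        (hA' _ _ _ _ hρ' hσ' h2.1 h2.2)
    -- If `V` were self-dual, `W` would be both `V` and `V*`, and either choice of `W'` would give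
    -- an excluded pair.
    have hc : IsComplexType ρ := (isComplexType_iff hρ).2 fun hd => by
      have h3 : Iso ρ σ := h1.elim id fun h4 => hd.symm.trans h4
      exact h2.elim (fun h4 => hn₁ ⟨h3, h4⟩) fun h4 => hn₂ ⟨hd.trans h3, h4⟩
    have hc' : IsComplexType ρ' := (isComplexType_iff hρ').2 fun hd => by
      have h3 : Iso ρ' σ' := h2.elim id fun h4 => hd.symm.trans h4
      exact h1.elim (fun h4 => hn₁ ⟨h4, h3⟩) fun h4 => hn₂ ⟨h4, hd.trans h3⟩
    obtain ⟨ha, ha'⟩ := h V V' ρ ρ' hρ hρ' hc hc'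
    rcases h1 with h1 | h1 <;> rcases h2 with h2 | h2
    · exact absurd ⟨h1, h2⟩ hn₁
    · rwa [aPoly_eq_of_iso hext.smooth (hρ.extTensor hρ'.dual).smooth (Iso.refl _)
        (h1.extTensor h2)] at ha'
    · rwa [aPoly_eq_of_iso hext.smooth (hρ.dual.extTensor hρ').smooth (Iso.refl _)
        (h1.extTensor h2)] at ha
    · exact absurd ⟨h1, h2⟩ hn₂
  · intro h V V' _ _ _ _ _ _ ρ ρ' hρ hρ' ht
    refine h _ _ (hρ.extTensor hρ') ?_
    rcases ht with ⟨h1, h2⟩ | ⟨-, h2⟩ | ⟨h1, -⟩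
    · exact Or.inl (h1.extTensor h2)
    · exact Or.inr (isComplexType_extTensor hρ hρ' (Or.inr h2))
    · exact Or.inr (isComplexType_extTensor hρ hρ' (Or.inl h1))
  · intro h U _ _ _ τ hτ ht
    obtain ⟨V, V', _, _, _, _, _, _, ρ, ρ', hρ, hρ', hiso⟩ := hτ.exists_iso_extTensor
    have hext := hρ.extTensor hρ'
    rw [← bPoly_eq_of_iso hext.smooth hiso]
    -- This rules out real times quaternionic, the only case covered neither by (b) on the factors
    -- nor by the assumption.
    have hnq : ¬ IsQuaternionicType (extTensor ρ ρ') := fun hq => by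
      have hq' : IsQuaternionicType τ :=
        isQuaternionicType_iff.2 ((isQuaternionicType_iff.1 hq).iso hiso)
      exact ht.elim (fun h1 => not_real_and_quaternionic hτ.irreducible ⟨h1, hq'⟩)
        fun h1 => h1.2 hq'
    have htype : ∀ {p q : Prop}, q ∨ p ∨ (¬ p ∧ ¬ q) := by tauto
    rcases (htype : IsQuaternionicType ρ ∨ IsRealType ρ ∨ IsComplexType ρ) with h1 | h1 <;>
      rcases (htype : IsQuaternionicType ρ' ∨ IsRealType ρ' ∨ IsComplexType ρ') with h2 | h2
    · exact h V V' ρ ρ' hρ hρ' (Or.inl ⟨h1, h2⟩)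
    · rcases h2 with h2 | h2
      · exact absurd (h1.extTensor_real h2) hnq
      · exact h V V' ρ ρ' hρ hρ' (Or.inr (Or.inl ⟨h1, h2⟩))
    · rcases h1 with h1 | h1
      · exact absurd (h1.extTensor_quaternionic h2) hnq
      · exact h V V' ρ ρ' hρ hρ' (Or.inr (Or.inr ⟨h1, h2⟩))
    · exact bPoly_extTensor_ne_zero hρ.smooth hρ'.smooth (hB V ρ hρ h1) (hB' V' ρ' hρ' h2)
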